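/- An orthogonal 1.5D terrain $T$ is an $x$-monotone polygonal chain $v_1,\dots,v_n$ (indexed from left to right) whose edges are alternately horizontal and vertical; assume that its first and last edges are vertical. Two vertices $p,q$ see each other if the segment $\overline{pq}$ is never strictly below $T$. Walking from left to right (with dummy horizontal edges before $v_1$ and after $v_n$), a vertex is convex (reflex) if we turn left (right) at it, and it is left (right) if we go from a vertical to a horizontal (from a horizontal to a vertical) edge at it. Let $V_r(T)$ be the set of reflex vertices and $V_{lc}(T)$ the set of left convex vertices. For $v\in V_{lc}(T)$ let $R(v)$ be the rightmost reflex vertex that sees $v$. Consider the following right-to-left sweep. It keeps a list $L(g)$ for each vertex $g$ and a stack $\mathcal{MS}$ of reflex vertices $g$, each with a vertex $obs(g)$, which defines the ray from $g$ through $obs(g)$; all lists and $\mathcal{MS}$ are empty at first. While there are vertices not yet handled, the next event is the rightmost one among the unhandled vertices (taken in decreasing order of index) and the unhandled points where the non-parallel rays of two vertices adjacent in $\mathcal{MS}$ meet at a point that is not an origin of either ray; ties in the $x$-coordinate between an intersection and the next vertex, or between intersections, are broken arbitrarily. The event $v$ is handled as follows. 1. $v$ left convex: pop $\mathcal{MS}$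 until it is empty, or its top sees $v$, or its top is to the right of $R(v)$. If then the top $g$ sees $v$, append $v$ to $L(g)$. Otherwise push $R(v)$ with $obs(R(v))=v$ and append $v$ to $L(R(v))$. 2. $v$ right convex: nothing is done. 3. $v$ left reflex: pop $\mathcal{MS}$ until it is empty or its top does not see $v$; push back the last popped vertex, if any, with $v$ as its new obstacle. 4. $v$ right reflex: let $u$ be the top of $\mathcal{MS}$. Pop $\mathcal{MS}$ as long as its top is lower than $v$. If $u$ is lower than $v$ and $L(u)$ consists of a single vertex $p$, move $p$ from $L(u)$ to $L(v)$ and push $v$, with $obs(v)$ the other endpoint of the horizontal edge at $v$ (immaterial if $v=v_1$). Then delete from $\mathcal{MS}$ all vertices that see $v$ except the rightmost one. 5. $v$ an intersection: if $v$ is strictly above $T$, delete from $\mathcal{MS}$ all vertices whose rays pass through $v$ except the rightmost one. When all vertices have been handled, the sweep returns $G=\{g : L(g)\ne\emptyset\}$. Lemma. Every run of the sweep on $T$ terminates after finitely many events, without getting stuck, and the returned set $G$ is an optimal solution of $\mathrm{OTGP}(V_r(T),V_{lc}(T))$: $G\subseteq V_r(T)$, every vertex of $V_{lc}(T)$ is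 seen by a vertex of $G$, and no set $G'\subseteq V_r(T)$ with this property has fewer elements than $G$. Moreover, the set $F$ of the first elements of the lists $L(g)$, $g\in G$, satisfies $|F|=|G|$, and no reflex vertex sees two different elements of $F$. -/

import Mathlib

noncomputable section

open scoped Classical

/-- The edge number `i` of a polygonal chain is horizontal, traversed from left to right. -/
def HorizontalEdge {m : ℕ} (P : Fin (m + 1) → ℝ × ℝ) (i : Fin m) : Prop :=
  (P i.castSucc).1 < (P i.succ).1 ∧ (P i.castSucc).2 = (P i.succ).2

/-- The edge number `i` of a polygonal chain is vertical (and not a single point). -/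
def VerticalEdge {m : ℕ} (P : Fin (m + 1) → ℝ × ℝ) (i : Fin m) : Prop :=
  (P i.castSucc).1 = (P i.succ).1 ∧ (P i.castSucc).2 ≠ (P i.succ).2

/-- An orthogonal 1.5D terrain with `m` edges and `m + 1` vertices, indexed from left to right:
every edge is horizontal or vertical, no two consecutive edges are both horizontal or both
vertical, and the chain begins and ends with vertical edges. -/
structure OrthogonalTerrain (m : ℕ) where
  vert : Fin (m + 1) → ℝ × ℝ
  edges_pos : 0 < m
  edge_cases : ∀ i : Fin m, HorizontalEdge vert i ∨ VerticalEdge vert i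
  alternate : ∀ i j : Fin m, (j : ℕ) = (i : ℕ) + 1 →
    ¬ (HorizontalEdge vert i ∧ HorizontalEdge vert j) ∧
    ¬ (VerticalEdge vert i ∧ VerticalEdge vert j)
  first_vertical : ∀ i : Fin m, (i : ℕ) = 0 → VerticalEdge vert i
  last_vertical : ∀ i : Fin m, (i : ℕ) + 1 = m → VerticalEdge vert i

/-- A ray kept by the sweep: the ray that starts at the vertex `origin` and passes through the
vertex `obstacle`.  It is an entry of the modified stack: a vertex with its current obstacle. -/
structure SweepRay (m : ℕ) where
  origin : Fin (m + 1)
  obstacle : Fin (m + 1)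

/-- The state of the sweep.  `events` holds the vertices not yet swept, the next one first;
`stack` is the modified stack, its top first; `pending` is the heap of those intersections of
rays adjacent in the stack that have not been handled (an intersection is represented by the two
rays); `lists g` is the list of left convex vertices associated to `g`, in order of insertion. -/
structure SweepState (m : ℕ) where
  events : List (Fin (m + 1))
  stack : List (SweepRay m)
  pending : Set (SweepRay m × SweepRay m)
  lists : Fin (m + 1) → List (Fin (m + 1))

namespace OrthogonalTerrain

variable {m : ℕ} (T : OrthogonalTerrain m)

/-! The terrain and visibility -/

/-- The `x`-coordinate of a vertex. -/
def x (v : Fin (m + 1)) : ℝ := (T.vert v).1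

/-- The `y`-coordinate of a vertex. -/
def y (v : Fin (m + 1)) : ℝ := (T.vert v).2

/-- The terrain as a set of points of the plane. -/
def carrier : Set (ℝ × ℝ) :=
  ⋃ i : Fin m, segment ℝ (T.vert i.castSucc) (T.vert i.succ)

/-- The point `z` lies strictly below the terrain. -/
def StrictlyBelow (z : ℝ × ℝ) : Prop :=
  (∃ t ∈ T.carrier, t.1 = z.1) ∧ ∀ t ∈ T.carrier, t.1 = z.1 → z.2 < t.2

/-- The point `z` lies strictly above the terrain. -/
def StrictlyAbove (z : ℝ × ℝ) : Prop :=
  (∃ t ∈ T.carrier, t.1 = z.1) ∧ ∀ t ∈ T.carrier, t.1 = z.1 → t.2 < z.2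

/-- Two vertices see each other if the segment between them is never strictly below the
terrain. -/
def Sees (p q : Fin (m + 1)) : Prop :=
  ∀ z ∈ segment ℝ (T.vert p) (T.vert q), ¬ T.StrictlyBelow z

/-! Classification of the vertices -/

/-- The direction of the edge entering `v` in a walk from left to right; the first vertex is
entered along a dummy horizontal edge. -/
def inDir (v : Fin (m + 1)) : ℝ × ℝ :=
  if (v : ℕ) = 0 then (1, 0) else T.vert v - T.vert ⟨(v : ℕ) - 1, by omega⟩

/-- The direction of the edge leaving `v` in a walk from left to right; the last vertex is
left along a dummy horizontal edge. -/
def outDir (v : Fin (m + 1)) : ℝ × ℝ :=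
  if h : (v : ℕ) < m then T.vert ⟨(v : ℕ) + 1, by omega⟩ - T.vert v else (1, 0)

/-- The cross product of two vectors of the plane; it is positive for a left turn. -/
def cross (a b : ℝ × ℝ) : ℝ := a.1 * b.2 - a.2 * b.1

/-- Convex vertex: the walk turns left. -/
def IsConvex (v : Fin (m + 1)) : Prop := 0 < cross (T.inDir v) (T.outDir v)

/-- Reflex vertex: the walk turns right. -/
def IsReflex (v : Fin (m + 1)) : Prop := cross (T.inDir v) (T.outDir v) < 0

/-- Left vertex: the walk goes from a vertical to a horizontal edge. -/
def IsLeft (v : Fin (m + 1)) : Prop := (T.inDir v).1 = 0 ∧ (T.outDir v).2 = 0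

/-- Right vertex: the walk goes from a horizontal to a vertical edge. -/
def IsRight (v : Fin (m + 1)) : Prop := (T.inDir v).2 = 0 ∧ (T.outDir v).1 = 0

/-- The set of reflex vertices. -/
def reflexVertices : Finset (Fin (m + 1)) := Finset.univ.filter T.IsReflex

/-- The set of left convex vertices. -/
def leftConvexVertices : Finset (Fin (m + 1)) :=
  Finset.univ.filter (fun v => T.IsLeft v ∧ T.IsConvex v)

/-- `r` is the right horizon of `v`: the rightmost reflex vertex that sees `v`. -/
def IsRightHorizon (v r : Fin (m + 1)) : Prop :=
  T.IsReflex r ∧ T.Sees r v ∧ ∀ g, T.IsReflex g → T.Sees g v → T.x g ≤ T.x r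

/-! The guarding problem -/

/-- Every witness in `W` is seen by an element of `G`. -/
def Guards (G W : Finset (Fin (m + 1))) : Prop := ∀ w ∈ W, ∃ g ∈ G, T.Sees g w

/-- `G` is an optimal solution of the guarding problem with guard candidates `C` and
witnesses `W`. -/
def IsOptimalGuarding (C W G : Finset (Fin (m + 1))) : Prop :=
  G ⊆ C ∧ T.Guards G W ∧
    ∀ G' : Finset (Fin (m + 1)), G' ⊆ C → T.Guards G' W → G.card ≤ G'.card

/-! Rays and their intersections -/

/-- The points of the ray from the origin of `e` through its obstacle. -/
def rayPoints (e : SweepRay m) : Set (ℝ × ℝ) :=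
  {z | ∃ t : ℝ, 0 ≤ t ∧
    z = T.vert e.origin + t • (T.vert e.obstacle - T.vert e.origin)}

/-- The rays `e` and `f` are not parallel and cross in the point `z`, which is not the origin
of either of them. -/
def CrossAt (e f : SweepRay m) (z : ℝ × ℝ) : Prop :=
  cross (T.vert e.obstacle - T.vert e.origin) (T.vert f.obstacle - T.vert f.origin) ≠ 0 ∧
  z ∈ T.rayPoints e ∧ z ∈ T.rayPoints f ∧ z ≠ T.vert e.origin ∧ z ≠ T.vert f.origin

/-- The pairs of rays that are adjacent in the stack `s` and have an interior intersection. -/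
def adjacentCrossings (s : List (SweepRay m)) : Set (SweepRay m × SweepRay m) :=
  {t | [t.1, t.2] <:+: s ∧ ∃ z, T.CrossAt t.1 t.2 z}

/-- The heap after the stack has changed from `s` to `s'`: intersections of pairs that are no
longer adjacent are removed, those of newly adjacent pairs are inserted. -/
def refresh (H : Set (SweepRay m × SweepRay m)) (s s' : List (SweepRay m)) :
    Set (SweepRay m × SweepRay m) :=
  {t | t ∈ T.adjacentCrossings s' ∧ (t ∈ H ∨ t ∉ T.adjacentCrossings s)}

/-- Delete from the stack all entries with the property `p` except the one whose origin is
rightmost. -/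
def keepRightmost (p : SweepRay m → Prop) (s : List (SweepRay m)) : List (SweepRay m) :=
  s.filter (fun e => decide (p e → ∀ f ∈ s, p f → T.x f.origin ≤ T.x e.origin))

/-! Handling of the events -/

/-- Add `v` at the end of the list of `g`. -/
def addTo (L : Fin (m + 1) → List (Fin (m + 1))) (g v : Fin (m + 1)) :
    Fin (m + 1) → List (Fin (m + 1)) :=
  Function.update L g (L g ++ [v])

/-- Left convex vertex `v` with right horizon `r`: pop until the top sees `v` or is to the
right of `r`.  If then the top sees `v`, add `v` to its list; otherwise push `r` with obstacle
`v` and add `v` to the list of `r`. -/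
def handleLeftConvex (v r : Fin (m + 1)) (s : List (SweepRay m))
    (L : Fin (m + 1) → List (Fin (m + 1))) :
    List (SweepRay m) × (Fin (m + 1) → List (Fin (m + 1))) :=
  match s.dropWhile (fun e => decide (¬ (T.Sees e.origin v ∨ T.x r < T.x e.origin))) with
  | [] => ([⟨r, v⟩], addTo L r v)
  | e :: s' =>
    if T.Sees e.origin v then (e :: s', addTo L e.origin v)
    else (⟨r, v⟩ :: e :: s', addTo L r v)

/-- Left reflex vertex `v`: pop until the top does not see `v`, then push back the last popped
vertex (if there is one) with the obstacle `v`. -/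
def handleLeftReflex (v : Fin (m + 1)) (s : List (SweepRay m)) : List (SweepRay m) :=
  match (s.takeWhile (fun e => decide (T.Sees e.origin v))).getLast? with
  | none => s
  | some e => ⟨e.origin, v⟩ :: s.dropWhile (fun e => decide (T.Sees e.origin v))

/-- Right reflex vertex `v`, first part: pop as long as the top is lower than `v`.  If the old
top `u` is lower than `v` and its list consists of one vertex `p`, move `p` to the list of `v`
and push `v`; its obstacle is the other endpoint of the horizontal edge at `v`.  (The first
vertex of the terrain has no such edge; no ray is used after it has been swept.) -/
def rightReflexPush (v : Fin (m + 1)) (s : List (SweepRay m))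
    (L : Fin (m + 1) → List (Fin (m + 1))) :
    List (SweepRay m) × (Fin (m + 1) → List (Fin (m + 1))) :=
  let s' := s.dropWhile (fun e => decide (T.y e.origin < T.y v))
  match s.head? with
  | none => (s', L)
  | some u =>
    if T.y u.origin < T.y v then
      match L u.origin with
      | [p] => (⟨v, ⟨(v : ℕ) - 1, by omega⟩⟩ :: s',
          addTo (Function.update L u.origin []) v p)
      | _ => (s', L)
    else (s', L)

/-- Right reflex vertex `v`: after the first part, delete all vertices in the stack that see
`v` except the rightmost one. -/
def handleRightReflex (v : Fin (m + 1)) (s : List (SweepRay m))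
    (L : Fin (m + 1) → List (Fin (m + 1))) :
    List (SweepRay m) × (Fin (m + 1) → List (Fin (m + 1))) :=
  (T.keepRightmost (fun e => T.Sees e.origin v) (T.rightReflexPush v s L).1,
    (T.rightReflexPush v s L).2)

/-- Intersection `z`: if it is above the terrain, delete all vertices from the stack whose rays
pass through `z`, except the rightmost one. -/
def handleIntersection (z : ℝ × ℝ) (s : List (SweepRay m)) : List (SweepRay m) :=
  if T.StrictlyAbove z then T.keepRightmost (fun e => z ∈ T.rayPoints e) s else s

/-- `VertexUpdate v s L s' L'`: handling the vertex `v` turns the stack `s` and the lists `L`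
into `s'` and `L'`. -/
inductive VertexUpdate : Fin (m + 1) → List (SweepRay m) →
    (Fin (m + 1) → List (Fin (m + 1))) → List (SweepRay m) →
    (Fin (m + 1) → List (Fin (m + 1))) → Prop
  | leftConvex (v r s L) (hl : T.IsLeft v) (hc : T.IsConvex v) (hr : T.IsRightHorizon v r) :
      VertexUpdate v s L (T.handleLeftConvex v r s L).1 (T.handleLeftConvex v r s L).2
  | rightConvex (v s L) (hl : T.IsRight v) (hc : T.IsConvex v) :
      VertexUpdate v s L s L
  | leftReflex (v s L) (hl : T.IsLeft v) (hc : T.IsReflex v) :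
      VertexUpdate v s L (T.handleLeftReflex v s) L
  | rightReflex (v s L) (hl : T.IsRight v) (hc : T.IsReflex v) :
      VertexUpdate v s L (T.handleRightReflex v s L).1 (T.handleRightReflex v s L).2

/-! The sweep -/

/-- The initial state: the vertices are queued from right to left (by decreasing index), and
the stack, the heap and all lists are empty. -/
def initState (m : ℕ) : SweepState m where
  events := (List.finRange (m + 1)).reverse
  stack := []
  pending := ∅
  lists := fun _ => []

/-- One iteration of the main loop, which runs while the queue of vertices is nonempty.  The
next event is a rightmost one among the next vertex and the pending intersections; among events
with the same `x`-coordinate any choice between them is allowed. -/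
inductive Step : SweepState m → SweepState m → Prop
  | vertexEvent (S : SweepState m) (v : Fin (m + 1)) (vs : List (Fin (m + 1)))
      (s' : List (SweepRay m)) (L' : Fin (m + 1) → List (Fin (m + 1)))
      (hv : S.events = v :: vs)
      (hmax : ∀ t ∈ S.pending, ∀ z, T.CrossAt t.1 t.2 z → z.1 ≤ T.x v)
      (hupd : T.VertexUpdate v S.stack S.lists s' L') :
      Step S ⟨vs, s', T.refresh S.pending S.stack s', L'⟩
  | intersectionEvent (S : SweepState m) (v : Fin (m + 1)) (vs : List (Fin (m + 1)))
      (t : SweepRay m × SweepRay m) (z : ℝ × ℝ)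
      (hv : S.events = v :: vs) (ht : t ∈ S.pending) (hz : T.CrossAt t.1 t.2 z)
      (hvz : T.x v ≤ z.1)
      (hmax : ∀ t' ∈ S.pending, ∀ z', T.CrossAt t'.1 t'.2 z' → z'.1 ≤ z.1) :
      Step S ⟨S.events, T.handleIntersection z S.stack,
        T.refresh (S.pending \ {t}) S.stack (T.handleIntersection z S.stack), S.lists⟩

/-- The states that occur in some run of the sweep on `T`. -/
def Reachable (S : SweepState m) : Prop := Relation.ReflTransGen T.Step (initState m) S

end OrthogonalTerrain

/-- The returned set: all vertices with a nonempty list. -/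
def SweepState.output {m : ℕ} (S : SweepState m) : Finset (Fin (m + 1)) :=
  Finset.univ.filter (fun g => S.lists g ≠ [])

/-- The set of the first elements of the nonempty lists. -/
def SweepState.firsts {m : ℕ} (S : SweepState m) : Finset (Fin (m + 1)) :=
  Finset.univ.filter (fun v => ∃ g, (S.lists g).head? = some v)

end

/-!
Why the sweep is correct.  The edges at even positions are vertical and those at odd positions
horizontal, so a segment between two vertices has to be compared only with the vertices in between
(`sees_iff_vis`), and a left convex vertex is seen only from its right and from the upper end of its
own vertical edge (`sees_leftConvex_iff`).  The main tool is the order claim `vis_of_order`: if `w`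
sees `g` and `v` sees `h`, where `w`, `v`, `g`, `h` are ordered from left to right, then `w` sees
`h`.  Hence, among reflex vertices that see a common vertex `v`, the rightmost one sees everything to
the left of `v` that any of the others sees there.

Optimality is certified by the first elements of the lists.  A list is opened, with a first element
`v`, only when no entry of the stack sees `v`, and then it belongs to the right horizon of `v`.  The
invariant `GuardInvariant` states that if a reflex vertex that has been swept sees a first element,
then each unswept left convex vertex that it sees is also seen by an entry of the stack.  So no
reflex vertex sees two first elements (`ListInvariant.independent`), hence every guarding set has at
least as many elements as there are lists.

It remains to see that every deletion from the stack preserves this invariant.  Popped entries and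
entries that see a common right reflex vertex are dominated by the rightmost one by the order claim.
A right reflex vertex `v` needs care, as it may see a first element only at the foot of its own
vertical edge.  If the top of the stack is not lower than `v`, it dominates `v`.  Otherwise this foot
is a first element only if it is alone in its list, and then it is moved to the list of `v`.

The deletions at crossings rest on the geometry of the rays, `StackInvariant`.  A ray is never above
an unswept vertex seen by its origin, and it passes above the left reflex vertices that have been
swept; so the origin sees the next vertex on a left side exactly if this vertex is not below the
ray (`StackInvariant.vis_iff`).  Above the terrain, the rays are in the order of the stack: when an
order is reversed, two adjacent rays cross first, and such a crossing is still pending when the sweep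
line is to the right of it (`StackInvariant.order_of_no_crossing`).  Where rays meet above the
terrain, the rightmost origin sees whatever the others see further to the left, by gluing visibility
along its ray (`StackInvariant.exists_sees_of_crossing`).  Between the two vertices of a vertical
edge going down, no such crossing can be in the interior of the plateau to the right
(`StackInvariant.crossing_le_of_foot`), and one on the edge itself does not involve the top of the
stack, so that the top still has the foot of the edge as the last element of its list.

The sweep terminates since every event decreases, lexicographically, the number of unswept vertices,
the size of the stack, and the number of pending crossings (`SweepInvariant.measure_lt`).
-/

open scoped Classical List

namespace OrthogonalTerrain

variable {m : ℕ} (T : OrthogonalTerrain m)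

/-! ### The terrain as a step function -/

/-- The `x`-coordinate of the vertex number `k`, which is taken modulo `m + 1` for `k > m`. -/
noncomputable def xAt (k : ℕ) : ℝ := T.x (Fin.ofNat (m + 1) k)

/-- The `y`-coordinate of the vertex number `k`, which is taken modulo `m + 1` for `k > m`. -/
noncomputable def yAt (k : ℕ) : ℝ := T.y (Fin.ofNat (m + 1) k)

lemma xAt_val (v : Fin (m + 1)) : T.xAt v = T.x v := by
  simp [xAt]

lemma yAt_val (v : Fin (m + 1)) : T.yAt v = T.y v := by
  simp [yAt]

lemma x_mk {k : ℕ} (h : k < m + 1) : T.x ⟨k, h⟩ = T.xAt k :=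
  (T.xAt_val ⟨k, h⟩).symm

lemma y_mk {k : ℕ} (h : k < m + 1) : T.y ⟨k, h⟩ = T.yAt k :=
  (T.yAt_val ⟨k, h⟩).symm

lemma vert_mk {k : ℕ} (h : k < m + 1) : T.vert ⟨k, h⟩ = (T.xAt k, T.yAt k) := by
  rw [← T.x_mk h, ← T.y_mk h]; rfl

lemma vert_eq (v : Fin (m + 1)) : T.vert v = (T.xAt v, T.yAt v) := by
  rw [xAt_val, yAt_val]; rfl

lemma horizontalEdge_iff (i : Fin m) : HorizontalEdge T.vert i ↔
    T.xAt i < T.xAt (i + 1) ∧ T.yAt i = T.yAt (i + 1) := by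
  have h1 : T.vert i.castSucc = (T.xAt i, T.yAt i) := T.vert_eq _
  have h2 : T.vert i.succ = (T.xAt (i + 1), T.yAt (i + 1)) := by
    rw [T.vert_eq]; simp
  simp [HorizontalEdge, h1, h2]

lemma verticalEdge_iff (i : Fin m) : VerticalEdge T.vert i ↔
    T.xAt i = T.xAt (i + 1) ∧ T.yAt i ≠ T.yAt (i + 1) := by
  have h1 : T.vert i.castSucc = (T.xAt i, T.yAt i) := T.vert_eq _
  have h2 : T.vert i.succ = (T.xAt (i + 1), T.yAt (i + 1)) := by
    rw [T.vert_eq]; simp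
  simp [VerticalEdge, h1, h2]

lemma edge_of_parity (k : ℕ) (hk : k < m) :
    (k % 2 = 0 → VerticalEdge T.vert ⟨k, hk⟩) ∧ (k % 2 = 1 → HorizontalEdge T.vert ⟨k, hk⟩) := by
  induction k with
  | zero => exact ⟨fun _ => T.first_vertical _ rfl, by simp⟩
  | succ k ih =>
    have ih := ih (by omega)
    have hal := T.alternate ⟨k, by omega⟩ ⟨k + 1, hk⟩ rfl
    have hc := T.edge_cases ⟨k + 1, hk⟩
    constructor
    · intro h
      have := ih.2 (by omega)
      tauto
    · intro h
      have := ih.1 (by omega)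
      tauto

lemma odd_card {m : ℕ} (T : OrthogonalTerrain m) : m % 2 = 1 := by
  have hm := T.edges_pos
  by_contra h
  have h1 := T.last_vertical ⟨m - 1, by omega⟩ (by simp; omega)
  have h2 := (T.edge_of_parity (m - 1) (by omega)).2 (by omega)
  exact h1.1.not_lt h2.1

variable {T}

lemma xAt_even {k : ℕ} (h : k % 2 = 0) (hk : k ≤ m) : T.xAt (k + 1) = T.xAt k := by
  have := T.odd_card
  exact (((T.verticalEdge_iff _).1 ((T.edge_of_parity k (by omega)).1 h)).1).symm

lemma yAt_even {k : ℕ} (h : k % 2 = 0) (hk : k ≤ m) : T.yAt k ≠ T.yAt (k + 1) := by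
  have := T.odd_card
  exact ((T.verticalEdge_iff _).1 ((T.edge_of_parity k (by omega)).1 h)).2

lemma xAt_odd {k : ℕ} (h : k % 2 = 1) (hk : k < m) : T.xAt k < T.xAt (k + 1) :=
  ((T.horizontalEdge_iff _).1 ((T.edge_of_parity k hk).2 h)).1

lemma yAt_odd {k : ℕ} (h : k % 2 = 1) (hk : k < m) : T.yAt (k + 1) = T.yAt k :=
  ((T.horizontalEdge_iff _).1 ((T.edge_of_parity k hk).2 h)).2.symm

lemma xAt_mono {k l : ℕ} (h : k ≤ l) (hl : l ≤ m) : T.xAt k ≤ T.xAt l := by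
  induction l, h using Nat.le_induction with
  | base => exact le_rfl
  | succ l h ih =>
    refine (ih (by omega)).trans ?_
    rcases Nat.mod_two_eq_zero_or_one l with h0 | h1
    · exact (xAt_even h0 (by omega)).ge
    · exact (xAt_odd h1 (by omega)).le

lemma lt_of_xAt_lt {k l : ℕ} (hk : k ≤ m) (h : T.xAt k < T.xAt l) : k < l := by
  by_contra hc
  exact absurd (xAt_mono (not_lt.1 hc) hk) (not_le.2 h)

/-- Two vertices have the same `x`-coordinate only if they bound a common vertical edge. -/
lemma xAt_lt_of_lt {k l : ℕ} (h : k < l) (hl : l ≤ m) (hne : k % 2 = 1 ∨ k + 1 < l) :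
    T.xAt k < T.xAt l := by
  rcases Nat.mod_two_eq_zero_or_one k with h0 | h1
  · have : k + 1 < l := by omega
    calc T.xAt k ≤ T.xAt (k + 1) := xAt_mono (by omega) (by omega)
      _ < T.xAt (k + 1 + 1) := xAt_odd (by omega) (by omega)
      _ ≤ T.xAt l := xAt_mono (by omega) hl
  · exact (xAt_odd h1 (by omega)).trans_le (xAt_mono (by omega) hl)

/-- The vertical line through an interior point of a horizontal edge meets no other edge. -/
lemma carrier_over_plateau {k : ℕ} (h : k % 2 = 1) (hk : k < m) {t : ℝ × ℝ} (ht : t ∈ T.carrier)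
    (h1 : T.xAt k < t.1) (h2 : t.1 < T.xAt (k + 1)) : t.2 = T.yAt k := by
  simp only [carrier, Set.mem_iUnion] at ht
  obtain ⟨i, hi⟩ := ht
  have e1 : T.vert i.castSucc = (T.xAt i, T.yAt i) := T.vert_eq _
  have e2 : T.vert i.succ = (T.xAt (i + 1), T.yAt (i + 1)) := by rw [T.vert_eq]; simp
  rw [e1, e2] at hi
  obtain ⟨a, b, ha, hb, hab, rfl⟩ := hi
  obtain rfl : a = 1 - b := by linarith
  simp only [Prod.smul_mk, smul_eq_mul, Prod.mk_add_mk] at h1 h2 ⊢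
  have hmono : T.xAt i ≤ T.xAt (i + 1) := xAt_mono (by omega) (by omega)
  have hlo : T.xAt i ≤ (1 - b) * T.xAt i + b * T.xAt (i + 1) := by
    nlinarith
  have hhi : (1 - b) * T.xAt i + b * T.xAt (i + 1) ≤ T.xAt (i + 1) := by
    nlinarith
  have hik : (i : ℕ) < k + 1 := lt_of_xAt_lt (by omega) (hlo.trans_lt h2)
  have hki : k < (i : ℕ) + 1 := lt_of_xAt_lt (by omega) (h1.trans_le hhi)
  obtain rfl : k = (i : ℕ) := by omega
  rw [yAt_odd h hk, ← add_mul, hab, one_mul]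

/-- No point of the terrain on the vertical line through a vertex is higher than all vertices on
this line. -/
lemma carrier_over_edge {k : ℕ} (hk : k ≤ m) {t : ℝ × ℝ} (ht : t ∈ T.carrier)
    (h1 : t.1 = T.xAt k) : ∃ l ≤ m, T.xAt l = T.xAt k ∧ t.2 ≤ T.yAt l := by
  simp only [carrier, Set.mem_iUnion] at ht
  obtain ⟨i, hi⟩ := ht
  have e1 : T.vert i.castSucc = (T.xAt i, T.yAt i) := T.vert_eq _
  have e2 : T.vert i.succ = (T.xAt (i + 1), T.yAt (i + 1)) := by rw [T.vert_eq]; simp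
  rw [e1, e2] at hi
  obtain ⟨a, b, ha, hb, hab, rfl⟩ := hi
  obtain rfl : a = 1 - b := by linarith
  simp only [Prod.smul_mk, smul_eq_mul, Prod.mk_add_mk] at h1 ⊢
  have hi := i.2
  rcases Nat.mod_two_eq_zero_or_one (i : ℕ) with h0 | h0
  · have hx := xAt_even (T := T) h0 (by omega)
    have hxk : T.xAt i = T.xAt k := by
      rw [hx, ← add_mul, hab, one_mul] at h1; exact h1
    rcases le_total (T.yAt i) (T.yAt (i + 1)) with hy | hy
    · exact ⟨i + 1, by omega, hx.trans hxk, by nlinarith⟩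
    · exact ⟨i, by omega, hxk, by nlinarith⟩
  · have hx := xAt_odd (T := T) h0 hi
    have hy := yAt_odd (T := T) h0 hi
    rw [hy, ← add_mul, hab, one_mul]
    rcases Nat.lt_or_ge (i : ℕ) k with hlt | hge
    · have : T.xAt (i + 1) ≤ T.xAt k := xAt_mono hlt hk
      exact ⟨i + 1, by omega, le_antisymm this (by nlinarith), hy.ge⟩
    · have : T.xAt k ≤ T.xAt i := xAt_mono hge (by omega)
      exact ⟨i, by omega, le_antisymm (by nlinarith) this, le_rfl⟩

lemma vertex_mem_carrier {k : ℕ} (hk : k ≤ m) : (T.xAt k, T.yAt k) ∈ T.carrier := by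
  have hm := T.edges_pos
  simp only [carrier, Set.mem_iUnion]
  by_cases h : k < m
  · refine ⟨⟨k, h⟩, ?_⟩
    have e1 : T.vert (Fin.castSucc ⟨k, h⟩) = (T.xAt k, T.yAt k) := T.vert_eq _
    rw [← e1]
    exact left_mem_segment ℝ _ _
  · refine ⟨⟨m - 1, by omega⟩, ?_⟩
    have e2 : T.vert (Fin.succ ⟨m - 1, by omega⟩) = (T.xAt k, T.yAt k) := by
      obtain rfl : k = m := by omega
      rw [T.vert_eq]; simp [show k - 1 + 1 = k by omega]
    rw [← e2]
    exact right_mem_segment ℝ _ _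

lemma plateau_mem_carrier {k : ℕ} (h : k % 2 = 1) (hk : k < m) {a : ℝ} (h1 : T.xAt k ≤ a)
    (h2 : a ≤ T.xAt (k + 1)) : (a, T.yAt k) ∈ T.carrier := by
  simp only [carrier, Set.mem_iUnion]
  refine ⟨⟨k, hk⟩, ?_⟩
  have e1 : T.vert (Fin.castSucc ⟨k, hk⟩) = (T.xAt k, T.yAt k) := T.vert_eq _
  have e2 : T.vert (Fin.succ ⟨k, hk⟩) = (T.xAt (k + 1), T.yAt k) := by
    rw [T.vert_eq]; simp [yAt_odd h hk]
  rw [e1, e2]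
  have hx := xAt_odd (T := T) h hk
  have hd : 0 < T.xAt (k + 1) - T.xAt k := by linarith
  refine ⟨(T.xAt (k + 1) - a) / (T.xAt (k + 1) - T.xAt k),
    (a - T.xAt k) / (T.xAt (k + 1) - T.xAt k), by apply div_nonneg <;> linarith,
    by apply div_nonneg <;> linarith, by field_simp; ring, ?_⟩
  ext <;> simp <;> field_simp <;> ring

lemma strictlyAbove_plateau {k : ℕ} (h : k % 2 = 1) (hk : k < m) {z : ℝ × ℝ}
    (h1 : T.xAt k < z.1) (h2 : z.1 < T.xAt (k + 1)) (hz : T.yAt k < z.2) : T.StrictlyAbove z :=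
  ⟨⟨_, plateau_mem_carrier h hk h1.le h2.le, rfl⟩, fun t ht htz => by
    rw [carrier_over_plateau h hk ht (htz ▸ h1) (htz ▸ h2)]; exact hz⟩

lemma strictlyBelow_plateau {k : ℕ} (h : k % 2 = 1) (hk : k < m) {z : ℝ × ℝ}
    (h1 : T.xAt k < z.1) (h2 : z.1 < T.xAt (k + 1)) (hz : z.2 < T.yAt k) : T.StrictlyBelow z :=
  ⟨⟨_, plateau_mem_carrier h hk h1.le h2.le, rfl⟩, fun t ht htz => by
    rw [carrier_over_plateau h hk ht (htz ▸ h1) (htz ▸ h2)]; exact hz⟩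

lemma strictlyAbove_edge {k : ℕ} (hk : k ≤ m) {z : ℝ × ℝ} (h1 : z.1 = T.xAt k)
    (hz : ∀ l ≤ m, T.xAt l = T.xAt k → T.yAt l < z.2) : T.StrictlyAbove z :=
  ⟨⟨_, vertex_mem_carrier hk, h1.symm⟩, fun t ht htz => by
    obtain ⟨l, hl, hxl, hyl⟩ := carrier_over_edge hk ht (htz.trans h1)
    exact hyl.trans_lt (hz l hl hxl)⟩

lemma StrictlyAbove.yAt_lt {k : ℕ} (hk : k ≤ m) {z : ℝ × ℝ} (hz : T.StrictlyAbove z)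
    (h : T.xAt k = z.1) : T.yAt k < z.2 :=
  hz.2 _ (vertex_mem_carrier hk) h

lemma StrictlyAbove.yAt_lt_of_plateau {k : ℕ} (h : k % 2 = 1) (hk : k < m) {z : ℝ × ℝ}
    (hz : T.StrictlyAbove z) (h1 : T.xAt k ≤ z.1) (h2 : z.1 ≤ T.xAt (k + 1)) : T.yAt k < z.2 :=
  hz.2 (z.1, T.yAt k) (plateau_mem_carrier h hk h1 h2) rfl

lemma not_strictlyBelow_of_mem {z t : ℝ × ℝ} (ht : t ∈ T.carrier) (h1 : t.1 = z.1)
    (h2 : t.2 ≤ z.2) : ¬ T.StrictlyBelow z :=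
  fun h => absurd (h.2 t ht h1) (not_lt.2 h2)

/-! ### Visibility in terms of the vertices between -/

variable (T) in
/-- The slope of the line through the vertices number `w` and `g`; it is `0` if that line is
vertical. -/
noncomputable def slopeAt (w g : ℕ) : ℝ := (T.yAt g - T.yAt w) / (T.xAt g - T.xAt w)

variable (T) in
/-- No vertex with an index between `w` and `g` lies above the line through the vertices number
`w` and `g`. -/
def Vis (w g : ℕ) : Prop :=
  ∀ k, w ≤ k → k ≤ g → T.yAt k ≤ T.yAt g + T.slopeAt w g * (T.xAt k - T.xAt g)

lemma yAt_eq_slopeAt {w g : ℕ} (h : T.xAt w < T.xAt g) :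
    T.yAt w = T.yAt g + T.slopeAt w g * (T.xAt w - T.xAt g) := by
  have : T.xAt g - T.xAt w ≠ 0 := by linarith
  unfold slopeAt; field_simp; ring

lemma exists_plateau_over {w g : ℕ} (hwg : w ≤ g) (hg : g ≤ m) (h : T.xAt w < T.xAt g) {a : ℝ}
    (h1 : T.xAt w ≤ a) (h2 : a ≤ T.xAt g) :
    ∃ k, k % 2 = 1 ∧ w ≤ k ∧ k + 1 ≤ g ∧ T.xAt k ≤ a ∧ a ≤ T.xAt (k + 1) := by
  induction g, hwg using Nat.le_induction with
  | base => exact absurd h (lt_irrefl _)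
  | succ g hwg ih =>
    rcases Nat.mod_two_eq_zero_or_one g with h0 | h0
    · have hx := xAt_even (T := T) h0 (by omega)
      obtain ⟨k, hk⟩ := ih (by omega) (hx ▸ h) (hx ▸ h2)
      exact ⟨k, hk.1, hk.2.1, by omega, hk.2.2.2⟩
    · rcases le_total (T.xAt g) a with ha | ha
      · exact ⟨g, h0, hwg, le_rfl, ha, h2⟩
      · by_cases hw : T.xAt w < T.xAt g
        · obtain ⟨k, hk⟩ := ih (by omega) hw ha
          exact ⟨k, hk.1, hk.2.1, by omega, hk.2.2.2⟩
        · exact ⟨g, h0, hwg, le_rfl, by linarith, h2⟩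

/-- An affine inequality that holds at two points holds between them. -/
lemma affine_le_of_mem_Icc {a s c b t d x₁ x x₂ : ℝ} (h1 : x₁ ≤ x) (h2 : x ≤ x₂)
    (A : a + s * (x₁ - c) ≤ b + t * (x₁ - d)) (B : a + s * (x₂ - c) ≤ b + t * (x₂ - d)) :
    a + s * (x - c) ≤ b + t * (x - d) := by
  rcases le_total s t with h | h <;> nlinarith

/-- Two lines that have crossed on the way from `x₂` to `x₁` do not cross again to the left of
`x₁`. -/
lemma affine_le_of_le_left {a s c b t d x x₁ x₂ : ℝ} (h1 : x ≤ x₁) (h2 : x₁ < x₂)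
    (A : b + t * (x₁ - d) ≤ a + s * (x₁ - c)) (B : a + s * (x₂ - c) ≤ b + t * (x₂ - d)) :
    b + t * (x - d) ≤ a + s * (x - c) := by
  have : s ≤ t := by
    by_contra hc
    push Not at hc
    nlinarith
  nlinarith

lemma mem_segment_right_left {w g : Fin (m + 1)} (h : T.xAt w < T.xAt g) {z : ℝ × ℝ} :
    z ∈ segment ℝ (T.vert g) (T.vert w) ↔ T.xAt w ≤ z.1 ∧ z.1 ≤ T.xAt g ∧
      z.2 = T.yAt g + T.slopeAt w g * (z.1 - T.xAt g) := by
  have hd : 0 < T.xAt g - T.xAt w := by linarith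
  rw [T.vert_eq, T.vert_eq]
  constructor
  · rintro ⟨a, b, ha, hb, hab, rfl⟩
    obtain rfl : a = 1 - b := by linarith
    simp only [Prod.smul_mk, smul_eq_mul, Prod.mk_add_mk]
    refine ⟨by nlinarith, by nlinarith, ?_⟩
    unfold slopeAt; field_simp; ring
  · rintro ⟨h1, h2, h3⟩
    refine ⟨(z.1 - T.xAt w) / (T.xAt g - T.xAt w), (T.xAt g - z.1) / (T.xAt g - T.xAt w),
      by apply div_nonneg <;> linarith, by apply div_nonneg <;> linarith, by field_simp; ring, ?_⟩
    ext
    · simp only [Prod.smul_mk, smul_eq_mul, Prod.mk_add_mk]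
      field_simp; ring
    · simp only [Prod.smul_mk, smul_eq_mul, Prod.mk_add_mk]
      rw [h3]; unfold slopeAt; field_simp; ring

/-- Visibility has to be tested only at the vertices in between. -/
lemma sees_iff_vis {w g : Fin (m + 1)} (h : T.xAt w < T.xAt g) : T.Sees g w ↔ T.Vis w g := by
  have hwg : (w : ℕ) < g := lt_of_xAt_lt (by omega) h
  have hgm : (g : ℕ) ≤ m := by omega
  have hw := yAt_eq_slopeAt h
  constructor
  · intro hs k hwk hkg
    by_contra hc
    push Not at hc
    -- near an end of the plateau at the vertex `k`, the segment is strictly below that plateau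
    rcases Nat.mod_two_eq_zero_or_one k with h0 | h0
    · have hkw : T.xAt w < T.xAt k := by
        refine lt_of_le_of_ne (xAt_mono hwk (by omega)) fun he => ?_
        rcases Nat.lt_or_ge (w : ℕ) k with hlt | hge
        · have := xAt_odd (T := T) (k := k - 1) (by omega) (by omega)
          have := xAt_mono (T := T) (k := w) (l := k - 1) (by omega) (by omega)
          rw [show k - 1 + 1 = k by omega] at *
          linarith
        · obtain rfl : k = (w : ℕ) := by omega
          linarith
      have hlt := lt_of_xAt_lt (by omega) hkw
      have ho : (k - 1) % 2 = 1 := by omega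
      have hx := xAt_odd (T := T) ho (by omega)
      have hy := yAt_odd (T := T) ho (by omega)
      rw [show k - 1 + 1 = k by omega] at hx hy
      have hcont : ContinuousAt (fun a : ℝ => T.yAt g + T.slopeAt w g * (a - T.xAt g))
        (T.xAt k) := by fun_prop
      have hev := hcont.eventually (gt_mem_nhds hc)
      obtain ⟨a, ha1, ha2, ha3⟩ :=
        ((hev.filter_mono nhdsWithin_le_nhds).and (Ioo_mem_nhdsLT hx)).exists
      have hxw : T.xAt w ≤ T.xAt (k - 1) := xAt_mono (by omega) (by omega)
      have hxg : T.xAt k ≤ T.xAt g := xAt_mono hkg hgm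
      exact hs (a, _)
        ((mem_segment_right_left h).2 ⟨by dsimp only; linarith, by dsimp only; linarith, rfl⟩)
        (strictlyBelow_plateau ho (by omega) (by simpa using ha2)
          (by rw [show k - 1 + 1 = k by omega]; simpa using ha3) (by simpa [← hy] using ha1))
    · have hkg' : T.xAt k < T.xAt g := by
        rcases Nat.lt_or_ge k g with hlt | hge
        · exact xAt_lt_of_lt hlt hgm (Or.inl h0)
        · obtain rfl : k = (g : ℕ) := by omega
          simp at hc
      have hlt := lt_of_xAt_lt (by omega) hkg'
      have hx := xAt_odd (T := T) h0 (by omega)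
      have hcont : ContinuousAt (fun a : ℝ => T.yAt g + T.slopeAt w g * (a - T.xAt g))
        (T.xAt k) := by fun_prop
      have hev := hcont.eventually (gt_mem_nhds hc)
      obtain ⟨a, ha1, ha2, ha3⟩ :=
        ((hev.filter_mono nhdsWithin_le_nhds).and (Ioo_mem_nhdsGT hx)).exists
      have hxw : T.xAt w ≤ T.xAt k := xAt_mono hwk (by omega)
      have hxg : T.xAt (k + 1) ≤ T.xAt g := xAt_mono hlt hgm
      exact hs (a, _)
        ((mem_segment_right_left h).2 ⟨by dsimp only; linarith, by dsimp only; linarith, rfl⟩)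
        (strictlyBelow_plateau h0 (by omega) (by simpa using ha2) (by simpa using ha3)
          (by simpa using ha1))
  · intro hv z hz
    obtain ⟨h1, h2, h3⟩ := (mem_segment_right_left h).1 hz
    obtain ⟨k, hk0, hwk, hkg, ha1, ha2⟩ := exists_plateau_over hwg.le hgm h h1 h2
    refine not_strictlyBelow_of_mem (plateau_mem_carrier hk0 (by omega) ha1 ha2) rfl ?_
    have e1 := hv k hwk (by omega)
    have e2 := hv (k + 1) (by omega) hkg
    rw [yAt_odd hk0 (by omega)] at e2
    rw [h3]
    have := affine_le_of_mem_Icc (a := T.yAt k) (s := 0) (c := 0) ha1 ha2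
      (by simpa using e1) (by simpa using e2)
    simpa using this

lemma sees_comm {p q : Fin (m + 1)} : T.Sees p q ↔ T.Sees q p := by
  unfold Sees; rw [segment_symm]

/-- The endpoints of a vertical edge see each other. -/
lemma sees_of_vertical {v w : Fin (m + 1)} (h : (w : ℕ) = v + 1) (h0 : (v : ℕ) % 2 = 0) :
    T.Sees v w := by
  intro z hz
  have hz' : z ∈ T.carrier := by
    simp only [carrier, Set.mem_iUnion]
    refine ⟨⟨v, by omega⟩, ?_⟩
    have e : Fin.succ ⟨(v : ℕ), by omega⟩ = w := Fin.ext h.symm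
    rw [e]
    exact hz
  exact not_strictlyBelow_of_mem hz' rfl le_rfl

/-! ### Types of vertices -/

variable (T) in
/-- The vertex number `k` is left convex: the foot of a vertical edge going down. -/
def LeftConvexAt (k : ℕ) : Prop := k % 2 = 1 ∧ k ≤ m ∧ T.yAt k < T.yAt (k - 1)

variable (T) in
/-- The vertex number `k` is left reflex: the top of a vertical edge going up. -/
def LeftReflexAt (k : ℕ) : Prop := k % 2 = 1 ∧ k ≤ m ∧ T.yAt (k - 1) < T.yAt k

variable (T) in
/-- The vertex number `k` is right reflex: the top of a vertical edge going down. -/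
def RightReflexAt (k : ℕ) : Prop := k % 2 = 0 ∧ k ≤ m ∧ T.yAt (k + 1) < T.yAt k

variable (T) in
/-- The vertex number `k` is right convex: the foot of a vertical edge going up. -/
def RightConvexAt (k : ℕ) : Prop := k % 2 = 0 ∧ k ≤ m ∧ T.yAt k < T.yAt (k + 1)

variable (T) in
/-- The vertex number `k` is reflex. -/
def ReflexAt (k : ℕ) : Prop := T.LeftReflexAt k ∨ T.RightReflexAt k

lemma ReflexAt.le {k : ℕ} (h : T.ReflexAt k) : k ≤ m := h.elim (·.2.1) (·.2.1)

lemma LeftConvexAt.not_reflexAt {k : ℕ} (h : T.LeftConvexAt k) : ¬ T.ReflexAt k := by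
  rintro (h' | h')
  · exact lt_asymm h.2.2 h'.2.2
  · have := h.1; have := h'.1; omega

lemma RightConvexAt.not_reflexAt {k : ℕ} (h : T.RightConvexAt k) : ¬ T.ReflexAt k := by
  rintro (h' | h')
  · have := h.1; have := h'.1; omega
  · exact lt_asymm h.2.2 h'.2.2

lemma LeftConvexAt.pred {k : ℕ} (h : T.LeftConvexAt k) : T.RightReflexAt (k - 1) := by
  obtain ⟨h1, h2, h3⟩ := h
  exact ⟨by omega, by omega, by rwa [show k - 1 + 1 = k by omega]⟩

lemma LeftReflexAt.pred {k : ℕ} (h : T.LeftReflexAt k) : T.RightConvexAt (k - 1) := by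
  obtain ⟨h1, h2, h3⟩ := h
  exact ⟨by omega, by omega, by rwa [show k - 1 + 1 = k by omega]⟩

lemma RightReflexAt.succ {k : ℕ} (h : T.RightReflexAt k) : T.LeftConvexAt (k + 1) := by
  obtain ⟨h1, h2, h3⟩ := h
  have := T.odd_card
  exact ⟨by omega, by omega, by simpa using h3⟩

lemma RightConvexAt.succ {k : ℕ} (h : T.RightConvexAt k) : T.LeftReflexAt (k + 1) := by
  obtain ⟨h1, h2, h3⟩ := h
  have := T.odd_card
  exact ⟨by omega, by omega, by simpa using h3⟩

lemma vertex_cases {k : ℕ} (hk : k ≤ m) :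
    T.LeftConvexAt k ∨ T.LeftReflexAt k ∨ T.RightConvexAt k ∨ T.RightReflexAt k := by
  rcases Nat.mod_two_eq_zero_or_one k with h | h
  · rcases lt_or_gt_of_ne (yAt_even (T := T) h hk) with h' | h'
    · exact Or.inr (Or.inr (Or.inl ⟨h, hk, h'⟩))
    · exact Or.inr (Or.inr (Or.inr ⟨h, hk, h'⟩))
  · have := yAt_even (T := T) (k := k - 1) (by omega) (by omega)
    rw [show k - 1 + 1 = k by omega] at this
    rcases lt_or_gt_of_ne this with h' | h'
    · exact Or.inr (Or.inl ⟨h, hk, h'⟩)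
    · exact Or.inl ⟨h, hk, h'⟩

lemma directions_of_even {v : Fin (m + 1)} (h : (v : ℕ) % 2 = 0) :
    (∃ a, 0 < a ∧ T.inDir v = (a, 0)) ∧ T.outDir v = (0, T.yAt (v + 1) - T.yAt v) := by
  have hm := T.odd_card
  have hv := v.2
  constructor
  · unfold inDir
    split_ifs with h0
    · exact ⟨1, one_pos, rfl⟩
    · have ho : ((v : ℕ) - 1) % 2 = 1 := by omega
      have hx := xAt_odd (T := T) ho (by omega)
      have hy := yAt_odd (T := T) ho (by omega)
      rw [Nat.sub_add_cancel (by omega)] at hx hy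
      exact ⟨_, sub_pos.2 hx, by rw [T.vert_eq, T.vert_mk]; simp [hy]⟩
  · unfold outDir
    rw [dif_pos (by omega), T.vert_eq, T.vert_mk]
    simp [xAt_even (T := T) h (by omega)]

lemma directions_of_odd {v : Fin (m + 1)} (h : (v : ℕ) % 2 = 1) :
    T.inDir v = (0, T.yAt v - T.yAt (v - 1)) ∧ ∃ a, 0 < a ∧ T.outDir v = (a, 0) := by
  have hv := v.2
  constructor
  · unfold inDir
    have hx := xAt_even (T := T) (k := (v : ℕ) - 1) (by omega) (by omega)
    rw [Nat.sub_add_cancel (by omega)] at hx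
    rw [if_neg (by omega), T.vert_eq, T.vert_mk]
    simp [hx]
  · unfold outDir
    split_ifs with h0
    · exact ⟨_, sub_pos.2 (xAt_odd (T := T) h h0), by
        rw [T.vert_eq, T.vert_mk]; simp [yAt_odd (T := T) h h0]⟩
    · exact ⟨1, one_pos, rfl⟩

lemma isReflex_iff {v : Fin (m + 1)} : T.IsReflex v ↔ T.ReflexAt v := by
  have hv : (v : ℕ) ≤ m := by omega
  rcases Nat.mod_two_eq_zero_or_one (v : ℕ) with h | h
  · obtain ⟨⟨a, ha, h1⟩, h2⟩ := directions_of_even (T := T) h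
    simp [IsReflex, h1, h2, cross, ReflexAt, LeftReflexAt, RightReflexAt, h, hv,
      mul_neg_iff, ha, ha.not_gt]
  · obtain ⟨h1, a, ha, h2⟩ := directions_of_odd (T := T) h
    simp [IsReflex, h1, h2, cross, ReflexAt, LeftReflexAt, RightReflexAt, h, hv, ha]

lemma isConvex_iff {v : Fin (m + 1)} : T.IsConvex v ↔ T.LeftConvexAt v ∨ T.RightConvexAt v := by
  have hv : (v : ℕ) ≤ m := by omega
  rcases Nat.mod_two_eq_zero_or_one (v : ℕ) with h | h
  · obtain ⟨⟨a, ha, h1⟩, h2⟩ := directions_of_even (T := T) h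
    simp [IsConvex, h1, h2, cross, LeftConvexAt, RightConvexAt, h, hv, ha]
  · obtain ⟨h1, a, ha, h2⟩ := directions_of_odd (T := T) h
    simp [IsConvex, h1, h2, cross, LeftConvexAt, RightConvexAt, h, hv, mul_neg_iff, ha,
      ha.not_gt]

lemma isLeft_iff {v : Fin (m + 1)} : T.IsLeft v ↔ (v : ℕ) % 2 = 1 := by
  rcases Nat.mod_two_eq_zero_or_one (v : ℕ) with h | h
  · obtain ⟨⟨a, ha, h1⟩, h2⟩ := directions_of_even (T := T) h
    simp [IsLeft, h1, h, ha.ne']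
  · obtain ⟨h1, a, ha, h2⟩ := directions_of_odd (T := T) h
    simp [IsLeft, h1, h2, h]

lemma isRight_iff {v : Fin (m + 1)} : T.IsRight v ↔ (v : ℕ) % 2 = 0 := by
  rcases Nat.mod_two_eq_zero_or_one (v : ℕ) with h | h
  · obtain ⟨⟨a, ha, h1⟩, h2⟩ := directions_of_even (T := T) h
    simp [IsRight, h1, h2, h]
  · obtain ⟨h1, a, ha, h2⟩ := directions_of_odd (T := T) h
    simp [IsRight, h2, h, ha.ne']

lemma leftConvexAt_iff {v : Fin (m + 1)} : T.LeftConvexAt v ↔ T.IsLeft v ∧ T.IsConvex v := by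
  rw [isLeft_iff, isConvex_iff]
  refine ⟨fun h => ⟨h.1, Or.inl h⟩, fun ⟨h, h'⟩ => h'.resolve_right fun hr => ?_⟩
  have := hr.1; omega

lemma rightConvexAt_iff {v : Fin (m + 1)} : T.RightConvexAt v ↔ T.IsRight v ∧ T.IsConvex v := by
  rw [isRight_iff, isConvex_iff]
  refine ⟨fun h => ⟨h.1, Or.inr h⟩, fun ⟨h, h'⟩ => h'.resolve_left fun hr => ?_⟩
  have := hr.1; omega

lemma leftReflexAt_iff {v : Fin (m + 1)} : T.LeftReflexAt v ↔ T.IsLeft v ∧ T.IsReflex v := by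
  rw [isLeft_iff, isReflex_iff]
  refine ⟨fun h => ⟨h.1, Or.inl h⟩, fun ⟨h, h'⟩ => h'.resolve_right fun hr => ?_⟩
  have := hr.1; omega

lemma rightReflexAt_iff {v : Fin (m + 1)} : T.RightReflexAt v ↔ T.IsRight v ∧ T.IsReflex v := by
  rw [isRight_iff, isReflex_iff]
  refine ⟨fun h => ⟨h.1, Or.inr h⟩, fun ⟨h, h'⟩ => h'.resolve_left fun hr => ?_⟩
  have := hr.1; omega

/-- Distinct reflex vertices lie on distinct vertical edges. -/
lemma ReflexAt.xAt_lt {g h : ℕ} (hg : T.ReflexAt g) (hh : T.ReflexAt h) (hlt : g < h) :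
    T.xAt g < T.xAt h := by
  refine xAt_lt_of_lt hlt hh.le ?_
  by_contra hc
  push Not at hc
  obtain rfl : h = g + 1 := by omega
  have h1 := hg.resolve_left fun h => hc.1 h.1
  exact h1.succ.not_reflexAt hh

/-! ### The order claim and other rules for visibility -/

lemma Vis.slopeAt_nonneg {w g : ℕ} (hw : w % 2 = 1) (hwg : w < g) (hg : g ≤ m)
    (h : T.Vis w g) : 0 ≤ T.slopeAt w g := by
  have hx := xAt_odd (T := T) hw (by omega)
  have h1 := h (w + 1) (by omega) hwg
  have h2 := yAt_eq_slopeAt (xAt_lt_of_lt (T := T) hwg hg (Or.inl hw))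
  rw [yAt_odd hw (by omega)] at h1
  by_contra hc
  push Not at hc
  nlinarith

lemma Vis.yAt_le_of_mem {w k g : ℕ} (hw : w % 2 = 1) (hwg : w < g) (hg : g ≤ m)
    (h : T.Vis w g) (h1 : w ≤ k) (h2 : k ≤ g) : T.yAt k ≤ T.yAt g := by
  have h3 := h.slopeAt_nonneg hw hwg hg
  have h4 := h k h1 h2
  have h5 := xAt_mono (T := T) h2 hg
  nlinarith

lemma Vis.yAt_ge_of_even {w g : ℕ} (hx : T.xAt w < T.xAt g) (hg : g % 2 = 0) (hgm : g ≤ m)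
    (h : T.Vis w g) (hw : w ≤ m) : T.yAt g ≤ T.yAt w := by
  have hwg := lt_of_xAt_lt hw hx
  have h1 := h (g - 1) (by omega) (by omega)
  have h2 := xAt_odd (T := T) (k := g - 1) (by omega) (by omega)
  have h3 := yAt_odd (T := T) (k := g - 1) (by omega) (by omega)
  rw [Nat.sub_add_cancel (by omega)] at h2 h3
  rw [← h3] at h1
  have h4 : T.slopeAt w g ≤ 0 := by
    by_contra hc
    push Not at hc
    nlinarith
  have h5 := yAt_eq_slopeAt hx
  nlinarith

/-- Walking to the right from a vertex on or below a nondecreasing line, the terrain can exceed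
the line for the first time only at a left reflex vertex. -/
lemma yAt_le_line_of_leftReflex {v g : ℕ} {s : ℝ} (hg : g ≤ m) (hs : 0 ≤ s)
    (hv : T.yAt v ≤ T.yAt g + s * (T.xAt v - T.xAt g))
    (hclear : ∀ k, T.LeftReflexAt k → v < k → k < g →
      T.yAt k ≤ T.yAt g + s * (T.xAt k - T.xAt g)) :
    ∀ k, v ≤ k → k ≤ g → T.yAt k ≤ T.yAt g + s * (T.xAt k - T.xAt g) := by
  intro k hk
  induction k, hk using Nat.le_induction with
  | base => exact fun _ => hv
  | succ k hvk ih =>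
    intro hkg
    have ih := ih (by omega)
    rcases Nat.mod_two_eq_zero_or_one k with h0 | h0
    · rcases lt_or_gt_of_ne (yAt_even (T := T) h0 (by omega)) with hlt | hgt
      · rcases Nat.lt_or_ge (k + 1) g with hlt' | hge
        · exact hclear (k + 1) ⟨by omega, by omega, by simpa using hlt⟩ (by omega) hlt'
        · obtain rfl : k + 1 = g := by omega
          simp
      · rw [xAt_even h0 (by omega)]
        exact hgt.le.trans ih
    · have hxk := xAt_odd (T := T) h0 (by omega)
      rw [yAt_odd h0 (by omega)]
      nlinarith

/-- A ray from `g` that passes above all left reflex vertices but not above `v` certifies that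
`v` is visible. -/
lemma vis_of_ray {v g : ℕ} {s : ℝ} (hg : g ≤ m) (hx : T.xAt v < T.xAt g)
    (hlow : T.yAt g + s * (T.xAt v - T.xAt g) ≤ T.yAt v) (hy : T.yAt v ≤ T.yAt g)
    (hclear : ∀ k, T.LeftReflexAt k → v < k → k < g →
      T.yAt k ≤ T.yAt g + s * (T.xAt k - T.xAt g)) : T.Vis v g := by
  have hv := yAt_eq_slopeAt hx
  have hs0 : 0 ≤ T.slopeAt v g := by
    by_contra hc
    push Not at hc
    nlinarith
  have hs1 : T.slopeAt v g ≤ s := by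
    by_contra hc
    push Not at hc
    nlinarith
  refine yAt_le_line_of_leftReflex hg hs0 hv.le fun k hk hvk hkg => ?_
  have h1 := hclear k hk hvk hkg
  have h2 := xAt_mono (T := T) hkg.le hg
  nlinarith

/-- Gluing of visibility: if `w` sees `g`, and a line through `h` passes above everything from `g`
to `h` but not above `w`, then `w` sees `h`.  The segment from `w` to `h` is above both the
segment from `w` to `g` and that line. -/
lemma vis_glue {w g h : ℕ} {s : ℝ} (hwg : T.xAt w < T.xAt g) (hgh : T.xAt g < T.xAt h)
    (hg : g ≤ m) (hh : h ≤ m) (hw : T.Vis w g)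
    (hlow : T.yAt h + s * (T.xAt w - T.xAt h) ≤ T.yAt w)
    (hclear : ∀ k, g ≤ k → k ≤ h → T.yAt k ≤ T.yAt h + s * (T.xAt k - T.xAt h)) :
    T.Vis w h := by
  have e1 := yAt_eq_slopeAt (hwg.trans hgh)
  have e2 := yAt_eq_slopeAt hwg
  have hgh' := lt_of_xAt_lt hg hgh
  have hup : ∀ x, T.xAt w ≤ x → x ≤ T.xAt h →
      T.yAt h + s * (x - T.xAt h) ≤ T.yAt h + T.slopeAt w h * (x - T.xAt h) :=
    fun x h1 h2 => affine_le_of_mem_Icc h1 h2 (hlow.trans e1.le) (by simp)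
  intro k hwk hkh
  rcases le_total g k with hgk | hkg
  · exact (hclear k hgk hkh).trans (hup _
      (hwg.le.trans (xAt_mono hgk (by omega))) (xAt_mono hkh hh))
  · refine (hw k hwk hkg).trans (affine_le_of_mem_Icc (xAt_mono hwk (by omega))
      (xAt_mono hkg hg) (e2.symm.trans e1).le ?_)
    have := hclear g le_rfl hgh'.le
    have := hup _ hwg.le hgh.le
    linarith

/-- The order claim: if `w` sees `g` and `v` sees `h`, where `w`, `v`, `g`, `h` are ordered from
left to right, then `w` sees `h`. -/
lemma vis_of_order {w v g h : ℕ} (hwv : w ≤ v) (hvg : T.xAt v < T.xAt g)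
    (hgh : T.xAt g < T.xAt h) (hv : v ≤ m) (hg : g ≤ m) (hh : h ≤ m) (hw : T.Vis w g)
    (hvh : T.Vis v h) : T.Vis w h := by
  have hvg' := lt_of_xAt_lt hv hvg
  have hwv' := xAt_mono (T := T) hwv hv
  have e1 := yAt_eq_slopeAt (hvg.trans hgh)
  have e2 := yAt_eq_slopeAt (hwv'.trans_lt hvg)
  refine vis_glue (hwv'.trans_lt hvg) hgh hg hh hw (s := T.slopeAt v h) ?_
    fun k hk hkh => hvh k (hvg'.le.trans hk) hkh
  refine (affine_le_of_le_left hwv' hvg (e1.symm.le.trans (hw v hwv hvg'.le)) ?_).trans e2.symm.le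
  have := hvh g hvg'.le (lt_of_xAt_lt hg hgh).le
  simpa using this

/-- Visibility is transitive through a vertex that is not higher than the two others. -/
lemma vis_trans_of_le {w v h : ℕ} (hwv : T.xAt w < T.xAt v) (hvh : T.xAt v < T.xAt h)
    (hv : v ≤ m) (hh : h ≤ m) (hw : T.Vis w v) (hvis : T.Vis v h) (h1 : T.yAt v ≤ T.yAt w)
    (h2 : T.yAt v ≤ T.yAt h) : T.Vis w h := by
  have e1 := yAt_eq_slopeAt hvh
  refine vis_glue hwv hvh hv hh hw (s := T.slopeAt v h) ?_ fun k hk hkh => hvis k hk hkh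
  have : 0 ≤ T.slopeAt v h := by
    by_contra hc
    push Not at hc
    nlinarith
  nlinarith

/-- A left convex vertex is seen from the left only by the other endpoint of its vertical
edge. -/
lemma sees_leftConvex_iff {r f : Fin (m + 1)} (hr : T.ReflexAt r) (hf : T.LeftConvexAt f) :
    T.Sees r f ↔ (r : ℕ) + 1 = f ∨ (f < r ∧ T.Vis f r) := by
  have h1 := hf.1
  rcases lt_trichotomy (r : ℕ) f with hlt | heq | hgt
  · constructor
    · intro hs
      by_contra hc
      push Not at hc
      have hx := xAt_lt_of_lt (T := T) hlt hf.2.1 (Or.inr (by omega))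
      have hv := (sees_iff_vis hx).1 (sees_comm.1 hs) (f - 1) (by omega) (by omega)
      have he := xAt_even (T := T) (k := f - 1) (by omega) (by omega)
      rw [Nat.sub_add_cancel (by omega)] at he
      rw [he] at hv
      have := hf.2.2
      linarith
    · rintro (h | h)
      · exact sees_of_vertical h.symm (by omega)
      · exact absurd h.1 (by simpa using hlt.le)
  · rw [heq] at hr
    exact absurd hr hf.not_reflexAt
  · rw [sees_iff_vis (xAt_lt_of_lt hgt hr.le (Or.inl h1))]
    refine ⟨fun h => Or.inr ⟨hgt, h⟩, fun h => h.elim (fun h => by omega) (·.2)⟩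

/-! ### Rays and their crossings -/

variable (T) in
/-- The slope of a ray.  By convention it is `0` for a vertical ray, which thus counts as a
horizontal one.  The only vertical ray of the sweep starts at the last but one vertex, when the last
vertex is left convex; no crossing involves it, as it is never together with another ray in the
stack. -/
noncomputable def raySlope (e : SweepRay m) : ℝ := T.slopeAt e.obstacle e.origin

variable (T) in
/-- The height at the abscissa `a` of the line that contains a ray. -/
noncomputable def rayHeight (e : SweepRay m) (a : ℝ) : ℝ :=
  T.yAt e.origin + T.raySlope e * (a - T.xAt e.origin)

lemma rayHeight_origin (e : SweepRay m) : T.rayHeight e (T.xAt e.origin) = T.yAt e.origin := by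
  simp [rayHeight]

lemma rayHeight_mk {g o : Fin (m + 1)} (h : T.xAt o < T.xAt g) :
    T.rayHeight ⟨g, o⟩ (T.xAt o) = T.yAt o :=
  (yAt_eq_slopeAt h).symm

lemma rayHeight_mono {e : SweepRay m} (h : 0 ≤ T.raySlope e) {a b : ℝ} (hab : a ≤ b) :
    T.rayHeight e a ≤ T.rayHeight e b := by
  unfold rayHeight; nlinarith

lemma rayHeight_le_of_mem_Icc {t e : SweepRay m} {a x b : ℝ} (h1 : a ≤ x) (h2 : x ≤ b)
    (ha : T.rayHeight t a ≤ T.rayHeight e a) (hb : T.rayHeight t b ≤ T.rayHeight e b) :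
    T.rayHeight t x ≤ T.rayHeight e x :=
  affine_le_of_mem_Icc h1 h2 ha hb

lemma mem_rayPoints_iff {e : SweepRay m} (h : T.xAt e.obstacle < T.xAt e.origin) {z : ℝ × ℝ} :
    z ∈ T.rayPoints e ↔ z.1 ≤ T.xAt e.origin ∧ z.2 = T.rayHeight e z.1 := by
  have hd : 0 < T.xAt e.origin - T.xAt e.obstacle := by linarith
  simp only [rayPoints, T.vert_eq, Set.mem_ofPred_eq, rayHeight, raySlope, slopeAt]
  constructor
  · rintro ⟨t, ht, rfl⟩
    simp only [Prod.mk_sub_mk, Prod.smul_mk, smul_eq_mul, Prod.mk_add_mk]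
    refine ⟨by nlinarith, by field_simp; ring⟩
  · rintro ⟨h1, h2⟩
    refine ⟨(T.xAt e.origin - z.1) / (T.xAt e.origin - T.xAt e.obstacle),
      div_nonneg (by linarith) hd.le, ?_⟩
    ext
    · simp only [Prod.mk_sub_mk, Prod.smul_mk, smul_eq_mul, Prod.mk_add_mk]
      field_simp; ring
    · simp only [Prod.mk_sub_mk, Prod.smul_mk, smul_eq_mul, Prod.mk_add_mk]
      rw [h2]; field_simp; ring

lemma crossAt_iff {e f : SweepRay m} (he : T.xAt e.obstacle < T.xAt e.origin)
    (hf : T.xAt f.obstacle < T.xAt f.origin) {z : ℝ × ℝ} :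
    T.CrossAt e f z ↔ T.raySlope e ≠ T.raySlope f ∧ z.1 < T.xAt e.origin ∧ z.1 < T.xAt f.origin ∧
      z.2 = T.rayHeight e z.1 ∧ z.2 = T.rayHeight f z.1 := by
  have hd : 0 < T.xAt e.origin - T.xAt e.obstacle := by linarith
  have hd' : 0 < T.xAt f.origin - T.xAt f.obstacle := by linarith
  have hne : ∀ {g : SweepRay m}, z.1 ≤ T.xAt g.origin → z.2 = T.rayHeight g z.1 →
      (z ≠ T.vert g.origin ↔ z.1 < T.xAt g.origin) := by
    intro g h1 h2
    rw [T.vert_eq]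
    constructor
    · refine fun hz => lt_of_le_of_ne h1 fun h => hz (Prod.ext h ?_)
      rw [h2, h, rayHeight_origin]
    · rintro h rfl
      exact lt_irrefl _ h
  have hcross : cross (T.vert e.obstacle - T.vert e.origin) (T.vert f.obstacle - T.vert f.origin)
      ≠ 0 ↔ T.raySlope e ≠ T.raySlope f := by
    rw [not_iff_not]
    simp only [T.vert_eq, cross, Prod.mk_sub_mk, raySlope, slopeAt]
    rw [div_eq_div_iff hd.ne' hd'.ne']
    constructor <;> intro h <;> linarith
  unfold CrossAt
  rw [hcross, mem_rayPoints_iff he, mem_rayPoints_iff hf]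
  constructor
  · rintro ⟨h0, ⟨h1, h2⟩, ⟨h3, h4⟩, h5, h6⟩
    exact ⟨h0, (hne h1 h2).1 h5, (hne h3 h4).1 h6, h2, h4⟩
  · rintro ⟨h0, h1, h2, h3, h4⟩
    exact ⟨h0, ⟨h1.le, h3⟩, ⟨h2.le, h4⟩, (hne h1.le h3).2 h1, (hne h2.le h4).2 h2⟩

/-- Two rays whose vertical order at `a` is opposite to that at `b` cross in between. -/
lemma exists_crossing {t e : SweepRay m} {a b : ℝ} (hab : a ≤ b)
    (ha : T.rayHeight e a < T.rayHeight t a) (hb : T.rayHeight t b ≤ T.rayHeight e b) :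
    T.raySlope t ≠ T.raySlope e ∧
      ∃ x, a < x ∧ x ≤ b ∧ T.rayHeight t x = T.rayHeight e x := by
  simp only [rayHeight] at *
  have hlt : T.raySlope t < T.raySlope e := by
    by_contra hc
    push Not at hc
    nlinarith
  have hd : 0 < T.raySlope e - T.raySlope t := by linarith
  refine ⟨hlt.ne, (T.yAt t.origin - T.raySlope t * T.xAt t.origin - T.yAt e.origin +
    T.raySlope e * T.xAt e.origin) / (T.raySlope e - T.raySlope t), ?_, ?_, ?_⟩
  · rw [lt_div_iff₀ hd]; nlinarith
  · rw [div_le_iff₀ hd]; nlinarith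
  · field_simp; ring

lemma mem_keepRightmost {p : SweepRay m → Prop} {s : List (SweepRay m)} {e : SweepRay m} :
    e ∈ T.keepRightmost p s ↔
      e ∈ s ∧ (p e → ∀ f ∈ s, p f → T.xAt f.origin ≤ T.xAt e.origin) := by
  simp [keepRightmost, xAt_val]
  exact fun _ => imp_iff_not_or.symm

/-! ### Invariants of the stack -/

lemma rel_of_pair_sublist {α : Type*} {R : α → α → Prop} {l : List α} (h : l.Pairwise R) {a b : α}
    (hab : [a, b] <+ l) : R a b :=
  List.pairwise_iff_forall_sublist.1 h hab

variable (T) in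
/-- The properties of the stack `s` when the vertices with an index at least `N` have been swept.
The entries are sorted from the top to the bottom by the position of their origins, which are at
least as high as the part of the terrain that has been swept to their left (`high`); the rays pass
above all left reflex vertices that have been swept (`clear`) and above the origins of the entries
nearer to the top (`under`).  No ray is above an unswept vertex that its origin sees (`below`).
The rays are ordered at the sweep line in the same way as the entries, where rays below the terrain
are excepted (`order`, and `order_foot` between the two vertices of a vertical edge going down). -/
structure StackInvariant (N : ℕ) (s : List (SweepRay m)) : Prop where
  reflexAt : ∀ e ∈ s, T.ReflexAt e.origin
  le_origin : ∀ e ∈ s, N ≤ e.origin ∨ (N = m ∧ (e.origin : ℕ) + 1 = m)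
  sorted : s.Pairwise fun t e => (t.origin : ℕ) < e.origin
  high : ∀ e ∈ s, ∀ k, N ≤ k → k ≤ e.origin → T.yAt k ≤ T.yAt e.origin
  slope_nonneg : ∀ e ∈ s, 0 ≤ T.raySlope e
  below : ∀ e ∈ s, ∀ w < N, T.xAt w < T.xAt e.origin → T.Vis w e.origin →
    T.rayHeight e (T.xAt w) ≤ T.yAt w
  clear : ∀ e ∈ s, ∀ k, T.LeftReflexAt k → N ≤ k → k < e.origin →
    T.yAt k ≤ T.rayHeight e (T.xAt k)
  under : s.Pairwise fun t e => T.yAt t.origin ≤ T.rayHeight e (T.xAt t.origin)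
  not_vertical : ∀ e ∈ s, T.xAt e.obstacle < T.xAt e.origin ∨
    (s = [e] ∧ (e.origin : ℕ) + 1 = m ∧ ∀ k, N ≤ k → ¬ T.LeftReflexAt k)
  order_foot : T.LeftConvexAt N → s.Pairwise fun t e => ∀ a, T.xAt N ≤ a → a ≤ T.xAt t.origin →
    T.rayHeight t a ≤ T.rayHeight e a ∨ (a < T.xAt (N + 1) ∧ T.rayHeight t a ≤ T.yAt N)
  order : N ≤ m → ¬ T.LeftConvexAt N → s.Pairwise fun t e =>
    T.rayHeight t (T.xAt N) ≤ T.rayHeight e (T.xAt N) ∧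
      ∀ k ≤ m, T.xAt k = T.xAt N → T.yAt k < T.rayHeight e (T.xAt N)

namespace StackInvariant

variable {N v : ℕ} {s s' : List (SweepRay m)} {e t : SweepRay m}

lemma sublist (h : T.StackInvariant N s) (hs : s' <+ s) : T.StackInvariant N s' where
  reflexAt e he := h.reflexAt e (hs.subset he)
  le_origin e he := h.le_origin e (hs.subset he)
  sorted := h.sorted.sublist hs
  high e he := h.high e (hs.subset he)
  slope_nonneg e he := h.slope_nonneg e (hs.subset he)
  below e he := h.below e (hs.subset he)
  clear e he := h.clear e (hs.subset he)
  under := h.under.sublist hs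
  not_vertical e he := (h.not_vertical e (hs.subset he)).imp_right fun h' => by
    refine ⟨?_, h'.2⟩
    rw [h'.1, List.sublist_singleton] at hs
    rcases hs with rfl | rfl
    · simp at he
    · rfl
  order_foot hN := (h.order_foot hN).sublist hs
  order hN hN' := (h.order hN hN').sublist hs

/-- Sweeping the vertex `v` without changing rays. -/
lemma advance (h : T.StackInvariant (v + 1) s) (hs : s' <+ s)
    (hhigh : ∀ e ∈ s', T.yAt v ≤ T.yAt e.origin)
    (hclear : T.LeftReflexAt v → ∀ e ∈ s', T.yAt v ≤ T.rayHeight e (T.xAt v))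
    (hvert : T.LeftReflexAt v → ∀ e ∈ s', T.xAt e.obstacle < T.xAt e.origin)
    (hfoot : T.LeftConvexAt v → s'.Pairwise fun t e => ∀ a, T.xAt v ≤ a → a ≤ T.xAt t.origin →
      T.rayHeight t a ≤ T.rayHeight e a ∨ (a < T.xAt (v + 1) ∧ T.rayHeight t a ≤ T.yAt v))
    (hord : ¬ T.LeftConvexAt v → s'.Pairwise fun t e =>
      T.rayHeight t (T.xAt v) ≤ T.rayHeight e (T.xAt v) ∧
        ∀ k ≤ m, T.xAt k = T.xAt v → T.yAt k < T.rayHeight e (T.xAt v)) :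
    T.StackInvariant v s' := by
  have h := h.sublist hs
  refine ⟨h.reflexAt, fun e he => Or.inl ?_, h.sorted, fun e he k hk hke => ?_, h.slope_nonneg,
    fun e he w hw => h.below e he w (by omega), fun e he k hk hvk hke => ?_, h.under,
    fun e he => ?_, hfoot, fun _ => hord⟩
  · rcases h.le_origin e he with h1 | h1 <;> omega
  · rcases hk.eq_or_lt with rfl | hlt
    · exact hhigh e he
    · exact h.high e he k hlt hke
  · rcases hvk.eq_or_lt with rfl | hlt
    · exact hclear hk e he
    · exact h.clear e he k hk hlt hke
  · by_cases hv : T.LeftReflexAt v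
    · exact Or.inl (hvert hv e he)
    · refine (h.not_vertical e he).imp_right fun h' => ⟨h'.1, h'.2.1, fun k hk => ?_⟩
      rcases hk.eq_or_lt with rfl | hlt
      · exact hv
      · exact h'.2.2 k hlt

lemma pair_not_vertical (h : T.StackInvariant N s) (hte : [t, e] <+ s) :
    T.xAt t.obstacle < T.xAt t.origin ∧ T.xAt e.obstacle < T.xAt e.origin := by
  have hl := hte.length_le
  constructor
  · refine (h.not_vertical t (hte.subset (by simp))).resolve_right fun h' => ?_
    rw [h'.1] at hl; simp at hl
  · refine (h.not_vertical e (hte.subset (by simp))).resolve_right fun h' => ?_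
    rw [h'.1] at hl; simp at hl

lemma pair_lt (h : T.StackInvariant N s) (hte : [t, e] <+ s) : (t.origin : ℕ) < e.origin :=
  rel_of_pair_sublist h.sorted hte

lemma pair_xAt_lt (h : T.StackInvariant N s) (hte : [t, e] <+ s) :
    T.xAt t.origin < T.xAt e.origin :=
  (h.reflexAt t (hte.subset (by simp))).xAt_lt (h.reflexAt e (hte.subset (by simp)))
    (h.pair_lt hte)

/-- Two different entries occur in the order of their origins. -/
lemma pair_sublist (h : T.StackInvariant N s) (ht : t ∈ s) (he : e ∈ s)
    (hlt : (t.origin : ℕ) < e.origin) : [t, e] <+ s := by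
  have hs := h.sorted
  clear h
  induction s with
  | nil => simp at ht
  | cons a s ih =>
    rw [List.pairwise_cons] at hs
    rcases List.mem_cons.1 ht with rfl | ht'
    · rcases List.mem_cons.1 he with rfl | he'
      · exact absurd hlt (lt_irrefl _)
      · exact (List.singleton_sublist.2 he').cons_cons _
    · rcases List.mem_cons.1 he with rfl | he'
      · exact absurd (hs.1 t ht') (by omega)
      · exact (ih ht' he' hs.2).cons _

/-- The origins are sorted by height. -/
lemma yAt_origin_le (h : T.StackInvariant N s) (hte : [t, e] <+ s) :
    T.yAt t.origin ≤ T.yAt e.origin := by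
  have hlt := h.pair_lt hte
  have h1 := h.le_origin t (hte.subset (by simp))
  have h2 := h.le_origin e (hte.subset (by simp))
  rcases h1 with h1 | h1
  · exact h.high e (hte.subset (by simp)) _ h1 hlt.le
  · rcases h2 with h2 | h2
    · exfalso
      have : (e.origin : ℕ) = m := by omega
      have hr := h.reflexAt e (hte.subset (by simp))
      have hr' := h.reflexAt t (hte.subset (by simp))
      rw [this] at hr
      have hm := T.odd_card
      have h4 := hr.resolve_right fun h => by have := h.1; omega
      have h5 := h4.pred.not_reflexAt
      rw [show m - 1 = (t.origin : ℕ) by omega] at h5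
      exact h5 hr'
    · omega

/-- The next vertex `v` is seen by the origin of an entry if and only if it is not below the
ray. -/
lemma vis_iff (h : T.StackInvariant (v + 1) s) (he : e ∈ s) (hx : T.xAt v < T.xAt e.origin)
    (hy : T.yAt v ≤ T.yAt e.origin) :
    T.Vis v e.origin ↔ T.rayHeight e (T.xAt v) ≤ T.yAt v :=
  ⟨h.below e he v (by omega) hx, fun hlow =>
    vis_of_ray (h.reflexAt e he).le hx hlow hy fun k hk hvk hke => h.clear e he k hk hvk hke⟩

/-- A vertical ray occurs in the stack only as long as its origin sees the next left vertex. -/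
lemma vis_of_vertical (h : T.StackInvariant (v + 1) s) (he : e ∈ s) (hv : v % 2 = 1)
    (hve : ¬ T.xAt e.obstacle < T.xAt e.origin) (hvm : v < m) : T.Vis v e.origin := by
  obtain ⟨-, h2, h3⟩ := (h.not_vertical e he).resolve_left hve
  have hm := T.odd_card
  have hle : v + 2 ≤ m := by omega
  rcases hle.eq_or_lt with heq | hlt
  · have hx := xAt_odd (T := T) hv hvm
    have ho : (e.origin : ℕ) = v + 1 := by omega
    rw [ho]
    intro k h1 h2
    obtain rfl | rfl : k = v ∨ k = v + 1 := by omega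
    · exact (yAt_eq_slopeAt hx).le
    · simp
  · exfalso
    have hnr := h3 (m - 2) (by omega)
    rcases vertex_cases (T := T) (k := m - 2) (by omega) with h' | h' | h' | h'
    · have h4 := h'.2.2
      have h5 := h.high e he (m - 2 - 1) (by omega) (by omega)
      have h6 := yAt_odd (T := T) (k := m - 2) (by omega) (by omega)
      rw [show m - 2 + 1 = (e.origin : ℕ) by omega] at h6
      linarith
    · exact hnr h'
    · have := h'.1; omega
    · have := h'.1; omega

/-- If no two adjacent rays have crossed above the terrain to the right of the next left vertex
`v`, then over the swept region all rays are in the order of their entries, except that rays which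
are not above the plateau at `v` may be out of order over this plateau. -/
lemma order_of_no_crossing (h : T.StackInvariant (v + 1) s) (hv : v % 2 = 1) (hvm : v < m)
    (hcr : ∀ t ∈ T.adjacentCrossings s, ∀ z, T.CrossAt t.1 t.2 z → T.StrictlyAbove z →
      z.1 ≤ T.xAt v) :
    s.Pairwise fun t e => ∀ a, T.xAt v ≤ a → a ≤ T.xAt t.origin →
      T.rayHeight t a ≤ T.rayHeight e a ∨ (a < T.xAt (v + 1) ∧ T.rayHeight t a ≤ T.yAt v) := by
  have hlc : ¬ T.LeftConvexAt (v + 1) := fun h => by have := h.1; omega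
  have hord := h.order (by omega) hlc
  have hxv := xAt_odd (T := T) hv hvm
  have hnear : ∀ a, T.xAt v ≤ a → a ≤ T.xAt (v + 1) → s.Pairwise fun t e =>
      T.rayHeight t a ≤ T.rayHeight e a ∨ T.rayHeight t a ≤ T.yAt v := by
    intro a ha1 ha2
    let R : SweepRay m → SweepRay m → Prop := fun t e =>
      T.rayHeight t a ≤ T.rayHeight e a ∨ T.rayHeight t a ≤ T.yAt v
    have : IsTrans (SweepRay m) R := ⟨fun p q r h1 h2 => by
      rcases h1 with h1 | h1
      · rcases h2 with h2 | h2
        · exact Or.inl (h1.trans h2)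
        · exact Or.inr (h1.trans h2)
      · exact Or.inr h1⟩
    change s.Pairwise R
    rw [← List.isChain_iff_pairwise, List.isChain_iff_forall_rel_of_append_cons_cons]
    intro t e l₁ l₂ hs
    have hinf : [t, e] <:+: s := ⟨l₁, l₂, by simp [hs]⟩
    have hte := hinf.sublist
    obtain ⟨hnt, hne⟩ := h.pair_not_vertical hte
    have hte' := rel_of_pair_sublist hord hte
    by_contra hc
    simp only [R, not_or, not_le] at hc
    obtain ⟨hsl, x, hx1, hx2, hx3⟩ := exists_crossing ha2 hc.1 hte'.1
    have hts := hte.subset (show t ∈ [t, e] by simp)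
    have hto : v + 1 ≤ t.origin := by
      rcases h.le_origin t hts with h' | h'
      · exact h'
      · have := T.odd_card; omega
    have hxt : T.xAt (v + 1) ≤ T.xAt t.origin := xAt_mono hto (h.reflexAt t hts).le
    have hup : T.yAt v < T.rayHeight t x :=
      hc.2.trans_le (rayHeight_mono (h.slope_nonneg t hts) hx1.le)
    have habove : T.StrictlyAbove (x, T.rayHeight t x) := by
      rcases hx2.eq_or_lt with rfl | hlt
      · refine strictlyAbove_edge (k := v + 1) (by omega) rfl fun l hl hxl => ?_
        dsimp only
        rw [hx3]
        exact hte'.2 l hl hxl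
      · exact strictlyAbove_plateau hv hvm (ha1.trans_lt hx1) hlt hup
    have hxt' : x < T.xAt t.origin := by
      refine (hx2.trans hxt).lt_of_ne fun heq => ?_
      have := habove.yAt_lt (h.reflexAt t hts).le heq.symm
      rw [heq, rayHeight_origin] at this
      exact lt_irrefl _ this
    have hcross : T.CrossAt t e (x, T.rayHeight t x) :=
      (crossAt_iff hnt hne).2 ⟨hsl, hxt', hxt'.trans (h.pair_xAt_lt hte), rfl, hx3⟩
    have := hcr (t, e) ⟨hinf, _, hcross⟩ _ hcross habove
    exact absurd (ha1.trans_lt hx1) (not_lt.2 this)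
  rw [List.pairwise_iff_forall_sublist]
  intro t e hte a ha1 ha2
  rcases le_total a (T.xAt (v + 1)) with ha3 | ha3
  · rcases ha3.eq_or_lt with rfl | hlt
    · exact Or.inl (rel_of_pair_sublist hord hte).1
    · exact (rel_of_pair_sublist (hnear a ha1 ha3) hte).imp_right fun h' => ⟨hlt, h'⟩
  · refine Or.inl (rayHeight_le_of_mem_Icc ha3 ha2
      (rel_of_pair_sublist hord hte).1 ?_)
    rw [rayHeight_origin]
    exact rel_of_pair_sublist h.under hte

end StackInvariant

/-! ### The stack invariants at the vertex events -/

lemma ReflexAt.yAt_le_of_xAt_eq {v k : ℕ} (hv : T.ReflexAt v) (hk : k ≤ m)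
    (h : T.xAt k = T.xAt v) : T.yAt k ≤ T.yAt v := by
  rcases lt_trichotomy k v with hlt | rfl | hgt
  · by_cases hc : k % 2 = 1 ∨ k + 1 < v
    · exact absurd (xAt_lt_of_lt hlt hv.le hc) h.not_lt
    · obtain rfl : v = k + 1 := by omega
      exact (hv.resolve_right fun h' => by have := h'.1; omega).2.2.le
  · exact le_rfl
  · by_cases hc : v % 2 = 1 ∨ v + 1 < k
    · exact absurd (xAt_lt_of_lt hgt hk hc) h.not_gt
    · obtain rfl : k = v + 1 := by omega
      exact (hv.resolve_left fun h' => by have := h'.1; omega).2.2.le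

/-- A ray through the obstacle `o` is not above a vertex to the left of `o` seen from its
origin. -/
lemma rayHeight_le_of_vis {g o : Fin (m + 1)} {w : ℕ} (hx : T.xAt o < T.xAt g) (hwo : w ≤ o)
    (h : T.Vis w g) : T.rayHeight ⟨g, o⟩ (T.xAt w) ≤ T.yAt w := by
  have hog : (o : ℕ) < g := lt_of_xAt_lt (by omega) hx
  have hw := xAt_mono (T := T) hwo (by omega)
  rw [yAt_eq_slopeAt (hw.trans_lt hx)]
  refine affine_le_of_le_left hw hx ?_ (by simp)
  exact (rayHeight_mk hx).le.trans (h o hwo hog.le)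

lemma forall_mem_dropWhile_not {α : Type*} {p : α → Bool} {s : List α}
    (h : s.Pairwise fun t e => p e → p t) : ∀ e ∈ s.dropWhile p, ¬ p e := by
  induction s with
  | nil => simp
  | cons a s ih =>
    rw [List.pairwise_cons] at h
    intro e he
    by_cases ha : p a
    · rw [List.dropWhile_cons_of_pos ha] at he
      exact ih h.2 e he
    · rw [List.dropWhile_cons_of_neg ha] at he
      rcases List.mem_cons.1 he with rfl | he'
      · exact ha
      · exact fun hpe => ha (h.1 e he' hpe)

/-- The right horizon of a left convex vertex is to the right of it, unless this vertex is the
last one. -/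
lemma IsRightHorizon.lt {v r : Fin (m + 1)} (h : T.IsRightHorizon v r) (hv : T.LeftConvexAt v)
    (hvm : (v : ℕ) < m) : (v : ℕ) < r := by
  have hm := T.odd_card
  have hodd := hv.1
  have hx := xAt_odd (T := T) hodd hvm
  have hy := yAt_odd (T := T) hodd hvm
  suffices ∃ g : Fin (m + 1), T.ReflexAt g ∧ T.xAt v < T.xAt g ∧ T.Vis v g by
    obtain ⟨g, hg, hxg, hvis⟩ := this
    have := h.2.2 g (isReflex_iff.2 hg) ((sees_iff_vis hxg).2 hvis)
    rw [← xAt_val, ← xAt_val] at this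
    exact lt_of_xAt_lt (by omega) (hxg.trans_le this)
  rcases vertex_cases (T := T) (k := v + 1) (by omega) with h' | h' | h' | h'
  · have := h'.1; omega
  · have := h'.1; omega
  · have hs := h'.succ
    have hx2 := xAt_even (T := T) h'.1 (by omega)
    have hvx : T.xAt v < T.xAt (v + 1 + 1) := hx.trans_eq hx2.symm
    refine ⟨⟨v + 1 + 1, by omega⟩, Or.inl hs, hvx, fun k h1 h2 => ?_⟩
    dsimp only at h2 ⊢
    obtain rfl | rfl | rfl : k = v ∨ k = v + 1 ∨ k = v + 1 + 1 := by omega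
    · exact (yAt_eq_slopeAt hvx).le
    · rw [hx2]
      simpa using h'.2.2.le
    · simp
  · refine ⟨⟨v + 1, by omega⟩, Or.inr h', hx, fun k h1 h2 => ?_⟩
    dsimp only at h2 ⊢
    obtain rfl | rfl : k = v ∨ k = v + 1 := by omega
    · exact (yAt_eq_slopeAt hx).le
    · simp

lemma IsRightHorizon.lt_or_eq {v r : Fin (m + 1)} (h : T.IsRightHorizon v r)
    (hv : T.LeftConvexAt v) : (v : ℕ) < r ∨ ((v : ℕ) = m ∧ (r : ℕ) + 1 = m) := by
  rcases Nat.lt_or_ge (v : ℕ) m with hlt | hge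
  · exact Or.inl (h.lt hv hlt)
  · have := (sees_leftConvex_iff (isReflex_iff.1 h.1) hv).1 h.2.1
    omega

/-- The two outcomes of the handling of a left convex vertex. -/
lemma handleLeftConvex_cases (v r : Fin (m + 1)) (s : List (SweepRay m))
    (L : Fin (m + 1) → List (Fin (m + 1))) :
    (∃ e s', (s.dropWhile fun e => decide (¬ (T.Sees e.origin v ∨ T.x r < T.x e.origin))) =
        e :: s' ∧ T.Sees e.origin v ∧
        T.handleLeftConvex v r s L = (e :: s', addTo L e.origin v)) ∨
    ∃ d, (s.dropWhile fun e => decide (¬ (T.Sees e.origin v ∨ T.x r < T.x e.origin))) = d ∧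
      (∀ e s', d = e :: s' → ¬ T.Sees e.origin v ∧ T.x r < T.x e.origin) ∧
      T.handleLeftConvex v r s L = (⟨r, v⟩ :: d, addTo L r v) := by
  unfold handleLeftConvex
  set p : SweepRay m → Bool :=
    fun e => decide (¬ (T.Sees e.origin v ∨ T.x r < T.x e.origin)) with hp
  rcases hd : s.dropWhile p with _ | ⟨e, s'⟩
  · exact Or.inr ⟨[], rfl, by simp, rfl⟩
  · by_cases hse : T.Sees e.origin v
    · exact Or.inl ⟨e, s', rfl, hse, by simp [hse]⟩
    · refine Or.inr ⟨e :: s', rfl, fun e' s'' h => ?_, by simp [hse]⟩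
      simp only [List.cons.injEq] at h
      rw [← h.1]
      have hne : s.dropWhile p ≠ [] := by simp [hd]
      have hhead := List.head_dropWhile_not p hne
      simp only [hd, List.head_cons] at hhead
      simp only [hp, decide_eq_false_iff_not, not_not, hse, false_or] at hhead
      exact ⟨hse, hhead⟩

namespace StackInvariant

variable {N : ℕ} {s s' : List (SweepRay m)} {e t : SweepRay m} {v r : Fin (m + 1)}

lemma nil : T.StackInvariant N [] := by
  constructor <;> simp

lemma push {g o : Fin (m + 1)} (h : T.StackInvariant N s) (hg : T.ReflexAt g)
    (hgo : N ≤ g ∨ (N = m ∧ (g : ℕ) + 1 = m)) (hlt : ∀ e ∈ s, (g : ℕ) < e.origin)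
    (hhigh : ∀ k, N ≤ k → k ≤ g → T.yAt k ≤ T.yAt g) (hslope : 0 ≤ T.raySlope ⟨g, o⟩)
    (hbelow : ∀ w < N, T.xAt w < T.xAt g → T.Vis w g → T.rayHeight ⟨g, o⟩ (T.xAt w) ≤ T.yAt w)
    (hclear : ∀ k, T.LeftReflexAt k → N ≤ k → k < g →
      T.yAt k ≤ T.rayHeight ⟨g, o⟩ (T.xAt k))
    (hunder : ∀ e ∈ s, T.yAt g ≤ T.rayHeight e (T.xAt g))
    (hvert : T.xAt o < T.xAt g ∨
      (s = [] ∧ (g : ℕ) + 1 = m ∧ ∀ k, N ≤ k → ¬ T.LeftReflexAt k))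
    (hvert' : ∀ e ∈ s, T.xAt e.obstacle < T.xAt e.origin)
    (hfoot : T.LeftConvexAt N → ∀ e ∈ s, ∀ a, T.xAt N ≤ a → a ≤ T.xAt g →
      T.rayHeight ⟨g, o⟩ a ≤ T.rayHeight e a ∨
        (a < T.xAt (N + 1) ∧ T.rayHeight ⟨g, o⟩ a ≤ T.yAt N))
    (hord : N ≤ m → ¬ T.LeftConvexAt N → ∀ e ∈ s,
      T.rayHeight ⟨g, o⟩ (T.xAt N) ≤ T.rayHeight e (T.xAt N) ∧
        ∀ k ≤ m, T.xAt k = T.xAt N → T.yAt k < T.rayHeight e (T.xAt N)) :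
    T.StackInvariant N (⟨g, o⟩ :: s) where
  reflexAt := List.forall_mem_cons.2 ⟨hg, h.reflexAt⟩
  le_origin := List.forall_mem_cons.2 ⟨hgo, h.le_origin⟩
  sorted := List.pairwise_cons.2 ⟨hlt, h.sorted⟩
  high := List.forall_mem_cons.2 ⟨hhigh, h.high⟩
  slope_nonneg := List.forall_mem_cons.2 ⟨hslope, h.slope_nonneg⟩
  below := List.forall_mem_cons.2 ⟨hbelow, h.below⟩
  clear := List.forall_mem_cons.2 ⟨hclear, h.clear⟩
  under := List.pairwise_cons.2 ⟨hunder, h.under⟩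
  not_vertical := List.forall_mem_cons.2 ⟨hvert.imp_right fun h' => ⟨by rw [h'.1], h'.2⟩,
    fun e he => Or.inl (hvert' e he)⟩
  order_foot hN := List.pairwise_cons.2 ⟨hfoot hN, h.order_foot hN⟩
  order hN hN' := List.pairwise_cons.2 ⟨hord hN hN', h.order hN hN'⟩

/-- Pushing a ray whose obstacle is the left vertex that has just been swept. -/
lemma push_seen {g : Fin (m + 1)} (h : T.StackInvariant v s) (hv : (v : ℕ) % 2 = 1)
    (hvg : (v : ℕ) < g) (hvis : T.Vis v g) (hg : T.ReflexAt g)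
    (hlt : ∀ e ∈ s, (g : ℕ) < e.origin) (hunder : ∀ e ∈ s, T.yAt g ≤ T.rayHeight e (T.xAt g))
    (hvert' : ∀ e ∈ s, T.xAt e.obstacle < T.xAt e.origin)
    (habove : ∀ e ∈ s, T.yAt v < T.rayHeight e (T.xAt v)) :
    T.StackInvariant v (⟨g, v⟩ :: s) := by
  have hx := xAt_lt_of_lt (T := T) hvg hg.le (Or.inl hv)
  refine h.push hg (Or.inl hvg.le) hlt
    (fun k => hvis.yAt_le_of_mem hv hvg hg.le) (hvis.slopeAt_nonneg hv hvg hg.le)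
    (fun w hw _ hwg => rayHeight_le_of_vis hx hw.le hwg)
    (fun k _ hk1 hk2 => hvis k hk1 hk2.le) hunder (Or.inl hx) hvert'
    (fun _ e he a ha1 ha2 => Or.inl (rayHeight_le_of_mem_Icc ha1 ha2 ?_ ?_))
    fun _ hN e he => ⟨?_, fun k hk hxk => ?_⟩
  · rw [rayHeight_mk hx]
    exact (habove e he).le
  · exact (rayHeight_origin (T := T) ⟨g, v⟩).le.trans (hunder e he)
  · rw [rayHeight_mk hx]
    exact (habove e he).le
  · have hr : T.ReflexAt v := by
      rcases vertex_cases (T := T) (k := v) (by omega) with h' | h' | h' | h'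
      · exact absurd h' hN
      · exact Or.inl h'
      · have := h'.1; omega
      · have := h'.1; omega
    exact (hr.yAt_le_of_xAt_eq hk hxk).trans_lt (habove e he)

lemma eq_nil_of_last (h : T.StackInvariant N s) (hN : m < N) : s = [] := by
  rw [List.eq_nil_iff_forall_not_mem]
  intro e he
  have := h.le_origin e he
  omega

lemma lt_origin (h : T.StackInvariant (v + 1) s) (hv : (v : ℕ) % 2 = 1) (he : e ∈ s) :
    (v : ℕ) < e.origin := by
  have := T.odd_card
  rcases h.le_origin e he with h' | h' <;> omega

lemma xAt_lt_origin (h : T.StackInvariant (v + 1) s) (hv : (v : ℕ) % 2 = 1) (he : e ∈ s) :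
    T.xAt v < T.xAt e.origin :=
  xAt_lt_of_lt (h.lt_origin hv he) (h.reflexAt e he).le (Or.inl hv)

lemma yAt_le_origin (h : T.StackInvariant (v + 1) s) (hv : (v : ℕ) % 2 = 1) (he : e ∈ s) :
    T.yAt v ≤ T.yAt e.origin := by
  have h1 := h.lt_origin hv he
  have h2 := h.high e he (v + 1) le_rfl h1
  rwa [yAt_odd hv (by omega)] at h2

lemma sees_iff (h : T.StackInvariant (v + 1) s) (hv : (v : ℕ) % 2 = 1) (he : e ∈ s) :
    T.Sees e.origin v ↔ T.rayHeight e (T.xAt v) ≤ T.yAt v :=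
  (sees_iff_vis (h.xAt_lt_origin hv he)).trans
    (h.vis_iff he (h.xAt_lt_origin hv he) (h.yAt_le_origin hv he))

lemma not_vertical_of_not_sees (h : T.StackInvariant (v + 1) s) (hv : (v : ℕ) % 2 = 1)
    (he : e ∈ s) (hs : ¬ T.Sees e.origin v) : T.xAt e.obstacle < T.xAt e.origin := by
  by_contra hc
  have := h.lt_origin hv he
  exact hs ((sees_iff_vis (h.xAt_lt_origin hv he)).2
    (h.vis_of_vertical he hv hc (by omega)))

lemma leftConvex_sublist (h : T.StackInvariant (v + 1) s) (hv : T.LeftConvexAt v)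
    (hs : s' <+ s)
    (hcr : ∀ t ∈ T.adjacentCrossings s, ∀ z, T.CrossAt t.1 t.2 z → T.StrictlyAbove z →
      z.1 ≤ T.xAt v) : T.StackInvariant v s' := by
  rcases Nat.lt_or_ge (v : ℕ) m with hlt | hge
  · refine h.advance hs (fun e he => h.yAt_le_origin hv.1 (hs.subset he))
      (fun h' => absurd (Or.inl h') hv.not_reflexAt) (fun h' => absurd (Or.inl h') hv.not_reflexAt)
      (fun _ => (h.order_of_no_crossing hv.1 hlt hcr).sublist hs) (fun h' => absurd hv h')
  · obtain rfl := h.eq_nil_of_last (by omega)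
    rw [List.sublist_nil.1 hs]
    exact nil

lemma leftConvex_push (h : T.StackInvariant (v + 1) s) (hv : T.LeftConvexAt v)
    (hr : T.IsRightHorizon v r) (hs : s' <+ s) (hlt : ∀ e ∈ s', (r : ℕ) < e.origin)
    (hcr : ∀ t ∈ T.adjacentCrossings s, ∀ z, T.CrossAt t.1 t.2 z → T.StrictlyAbove z →
      z.1 ≤ T.xAt v) : T.StackInvariant v (⟨r, v⟩ :: s') := by
  have h' := h.leftConvex_sublist hv hs hcr
  have hrr := isReflex_iff.1 hr.1
  rcases hr.lt_or_eq hv with hvr | ⟨h1, h2⟩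
  · have hx := xAt_lt_of_lt (T := T) hvr hrr.le (Or.inl hv.1)
    have hvis := (sees_iff_vis hx).1 hr.2.1
    have hns : ∀ e ∈ s', ¬ T.Sees e.origin v := fun e he hse => by
      have := hr.2.2 _ (isReflex_iff.2 (h'.reflexAt e he)) hse
      rw [← xAt_val, ← xAt_val] at this
      exact absurd (hrr.xAt_lt (h'.reflexAt e he) (hlt e he)) (not_lt.2 this)
    have habove : ∀ e ∈ s', T.yAt v < T.rayHeight e (T.xAt v) := fun e he =>
      not_le.1 fun hc => hns e he ((h.sees_iff hv.1 (hs.subset he)).2 hc)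
    refine h'.push_seen hv.1 hvr hvis hrr hlt (fun e he => ?_)
      (fun e he => h.not_vertical_of_not_sees hv.1 (hs.subset he) (hns e he)) habove
    rcases hrr with hl | hrr
    · exact h.clear e (hs.subset he) r hl hvr (hlt e he)
    · exact (hvis.yAt_ge_of_even hx hrr.1 hrr.2.1 (by omega)).trans ((habove e he).le.trans
        (rayHeight_mono (h'.slope_nonneg e he) hx.le))
  · obtain rfl := h.eq_nil_of_last (by omega)
    obtain rfl := List.sublist_nil.1 hs
    -- the ray is vertical, and its slope is `0` by convention
    have hx : T.xAt v = T.xAt r := by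
      rw [h1, ← xAt_even (T := T) (k := r) (by have := T.odd_card; omega) (by omega), h2]
    have hsl : T.raySlope ⟨r, v⟩ = 0 := by simp [raySlope, slopeAt, hx]
    refine nil.push hrr (Or.inr ⟨h1, h2⟩) (by simp) (fun k h3 h4 => by omega) hsl.ge
      (fun w hw hwr hwvis => ?_) (fun k _ _ _ => by omega) (by simp)
      (Or.inr ⟨rfl, h2, fun k hk hlr => ?_⟩) (by simp) (by simp) (by simp)
    · have hrv : (r : ℕ) % 2 = 0 := by have := T.odd_card; omega
      have := hwvis.yAt_ge_of_even hwr hrv hrr.le (by omega)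
      simpa [rayHeight, hsl] using this
    · have : k = v := by have := hlr.2.1; omega
      rw [this] at hlr
      exact hv.not_reflexAt (Or.inl hlr)

lemma leftConvex (h : T.StackInvariant (v + 1) s) (hv : T.LeftConvexAt v)
    (hr : T.IsRightHorizon v r) (L : Fin (m + 1) → List (Fin (m + 1)))
    (hcr : ∀ t ∈ T.adjacentCrossings s, ∀ z, T.CrossAt t.1 t.2 z → T.StrictlyAbove z →
      z.1 ≤ T.xAt v) : T.StackInvariant v (T.handleLeftConvex v r s L).1 := by
  have hsub := List.dropWhile_sublist (l := s)
    fun e => decide (¬ (T.Sees e.origin v ∨ T.x r < T.x e.origin))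
  rcases handleLeftConvex_cases (T := T) v r s L with ⟨e, s', hd, -, heq⟩ | ⟨d, hd, hns, heq⟩
  · rw [heq]
    exact h.leftConvex_sublist hv (hd ▸ hsub) hcr
  · rw [heq]
    rw [hd] at hsub
    refine h.leftConvex_push hv hr hsub ?_ hcr
    rcases d with _ | ⟨e, d⟩
    · simp
    · have hre := (hns e d rfl).2
      rw [← xAt_val, ← xAt_val] at hre
      have hre := lt_of_xAt_lt (by omega) hre
      have hsort := (List.pairwise_cons.1 (h.sorted.sublist hsub)).1
      exact List.forall_mem_cons.2 ⟨hre, fun e' he' => hre.trans (hsort e' he')⟩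

lemma leftReflex (h : T.StackInvariant (v + 1) s) (hv : T.LeftReflexAt v)
    (hcr : ∀ t ∈ T.adjacentCrossings s, ∀ z, T.CrossAt t.1 t.2 z → T.StrictlyAbove z →
      z.1 ≤ T.xAt v) : T.StackInvariant v (T.handleLeftReflex v s) := by
  rcases Nat.lt_or_ge (v : ℕ) m with hvm | hge
  swap
  · obtain rfl := h.eq_nil_of_last (by omega)
    exact nil
  have hlc : ¬ T.LeftConvexAt v := fun h' => h'.not_reflexAt (Or.inl hv)
  set p : SweepRay m → Bool := fun e => decide (T.Sees e.origin v) with hp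
  have hord := h.order_of_no_crossing hv.1 hvm hcr
  -- the entries that see `v` are those nearest to the top
  have hmono : s.Pairwise fun t e => p e → p t := by
    rw [List.pairwise_iff_forall_sublist]
    intro t e hte
    have ht := hte.subset (show t ∈ [t, e] by simp)
    have he := hte.subset (show e ∈ [t, e] by simp)
    simp only [hp, decide_eq_true_eq]
    rw [h.sees_iff hv.1 he, h.sees_iff hv.1 ht]
    intro h1
    rcases rel_of_pair_sublist hord hte _ le_rfl (h.xAt_lt_origin hv.1 ht).le with h2 | h2
    · exact h2.trans h1
    · exact h2.2
  have hsub := List.dropWhile_sublist (l := s) p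
  have hns : ∀ e ∈ s.dropWhile p, ¬ T.Sees e.origin v := fun e he => by
    simpa [hp] using forall_mem_dropWhile_not hmono e he
  have habove : ∀ e ∈ s.dropWhile p, T.yAt v < T.rayHeight e (T.xAt v) := fun e he =>
    not_le.1 fun hc => hns e he ((h.sees_iff hv.1 (hsub.subset he)).2 hc)
  have hvert : ∀ e ∈ s.dropWhile p, T.xAt e.obstacle < T.xAt e.origin := fun e he =>
    h.not_vertical_of_not_sees hv.1 (hsub.subset he) (hns e he)
  have hdrop : T.StackInvariant v (s.dropWhile p) := by
    refine h.advance hsub (fun e he => h.yAt_le_origin hv.1 (hsub.subset he))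
      (fun _ e he => (habove e he).le) (fun _ => hvert) (fun h' => absurd h' hlc) fun _ => ?_
    rw [List.pairwise_iff_forall_sublist]
    intro t e hte
    have ht := hte.subset (show t ∈ [t, e] by simp)
    have he := hte.subset (show e ∈ [t, e] by simp)
    refine ⟨(rel_of_pair_sublist hord (hte.trans hsub) _ le_rfl (h.xAt_lt_origin hv.1
      (hsub.subset ht)).le).resolve_right fun h' =>
      absurd (habove t ht) (not_lt.2 h'.2), fun k hk hxk => ?_⟩
    exact ((show T.ReflexAt v from Or.inl hv).yAt_le_of_xAt_eq hk hxk).trans_lt (habove e he)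
  have happ := List.takeWhile_append_dropWhile (p := p) (l := s)
  unfold handleLeftReflex
  split
  · rename_i hnone
    rw [List.getLast?_eq_none_iff] at hnone
    change s.takeWhile p = [] at hnone
    rw [hnone, List.nil_append] at happ
    rw [← happ]
    exact hdrop
  · rename_i e hsome
    have hmem : e ∈ s.takeWhile p := List.mem_of_getLast? hsome
    have hes : e ∈ s := (List.takeWhile_sublist p).subset hmem
    have hse : T.Sees e.origin v := by simpa [hp] using List.mem_takeWhile_imp hmem
    have hpair : ∀ e' ∈ s.dropWhile p, [e, e'] <+ s := fun e' he' => by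
      rw [← happ]
      exact (List.singleton_sublist.2 hmem).append (List.singleton_sublist.2 he')
    exact hdrop.push_seen hv.1 (h.lt_origin hv.1 hes)
      ((sees_iff_vis (h.xAt_lt_origin hv.1 hes)).1 hse) (h.reflexAt e hes)
      (fun e' he' => h.pair_lt (hpair e' he'))
      (fun e' he' => rel_of_pair_sublist h.under (hpair e' he')) hvert habove

lemma rightConvex (h : T.StackInvariant (v + 1) s) (hv : T.RightConvexAt v) :
    T.StackInvariant v s := by
  have hs := hv.succ
  have hlc : ¬ T.LeftConvexAt (v + 1) := fun h' => h'.not_reflexAt (Or.inl hs)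
  have hx := xAt_even (T := T) hv.1 hv.2.1
  refine h.advance (List.Sublist.refl s) (fun e he => ?_)
    (fun h' => absurd (Or.inl h') hv.not_reflexAt) (fun h' => absurd (Or.inl h') hv.not_reflexAt)
    (fun h' => by have := h'.1; have := hv.1; omega) fun _ => ?_
  · have hle : (v : ℕ) + 1 ≤ e.origin := by
      refine (h.le_origin e he).resolve_right fun h' => ?_
      have hr := h.reflexAt e he
      rw [show (e.origin : ℕ) = v by omega] at hr
      exact hv.not_reflexAt hr
    exact hv.2.2.le.trans (h.high e he _ le_rfl hle)
  · have := h.order hs.2.1 hlc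
    rwa [hx] at this

end StackInvariant

lemma sees_self (v : Fin (m + 1)) : T.Sees v v := by
  intro z hz
  rw [segment_same, Set.mem_singleton_iff] at hz
  refine not_strictlyBelow_of_mem (vertex_mem_carrier (k := v) (by omega)) ?_ ?_
  · rw [hz, T.vert_eq]
  · rw [hz, T.vert_eq]

lemma keepRightmost_cons (p : SweepRay m → Prop) (a : SweepRay m) (d : List (SweepRay m)) :
    (∃ d', d' <+ d ∧ T.keepRightmost p (a :: d) = a :: d') ∨ T.keepRightmost p (a :: d) <+ d := by
  unfold keepRightmost
  rw [List.filter_cons]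
  split
  · exact Or.inl ⟨_, List.filter_sublist, rfl⟩
  · exact Or.inr List.filter_sublist

/-- The two outcomes of the first part of the handling of a right reflex vertex. -/
lemma rightReflexPush_cases (v : Fin (m + 1)) (s : List (SweepRay m))
    (L : Fin (m + 1) → List (Fin (m + 1))) :
    (T.rightReflexPush v s L = (s.dropWhile fun e => decide (T.y e.origin < T.y v), L) ∧
      ∀ u s', s = u :: s' → T.y u.origin < T.y v → ∀ p, L u.origin ≠ [p]) ∨
    ∃ u s' p, s = u :: s' ∧ T.y u.origin < T.y v ∧ L u.origin = [p] ∧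
      T.rightReflexPush v s L =
        (⟨v, ⟨(v : ℕ) - 1, by omega⟩⟩ :: s.dropWhile fun e => decide (T.y e.origin < T.y v),
          addTo (Function.update L u.origin []) v p) := by
  unfold rightReflexPush
  rcases s with _ | ⟨u, s'⟩
  · simp
  · by_cases hu : T.y u.origin < T.y v
    · by_cases hp : ∃ p, L u.origin = [p]
      · obtain ⟨p, hp⟩ := hp
        exact Or.inr ⟨u, s', p, rfl, hu, hp, by simp [hu, hp]⟩
      · push Not at hp
        refine Or.inl ⟨?_, fun u' s'' h _ => by
          simp only [List.cons.injEq] at h; rw [← h.1]; exact hp⟩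
        simp only [List.head?_cons, if_pos hu]
    · refine Or.inl ⟨by simp [hu], fun u' s'' h h' => ?_⟩
      simp only [List.cons.injEq] at h
      exact absurd (h.1 ▸ h') hu

namespace StackInvariant

variable {N : ℕ} {s s' : List (SweepRay m)} {e t : SweepRay m} {v r : Fin (m + 1)}

lemma le_origin_of_succ (h : T.StackInvariant (v + 1) s) (he : e ∈ s) :
    (v : ℕ) ≤ e.origin := by
  rcases h.le_origin e he with h' | h' <;> omega

lemma yAt_le_of_mem_dropWhile (h : T.StackInvariant N s)
    (he : e ∈ s.dropWhile fun e => decide (T.y e.origin < T.y v)) :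
    T.yAt v ≤ T.yAt e.origin := by
  have := forall_mem_dropWhile_not (p := fun e : SweepRay m => decide (T.y e.origin < T.y v))
    (s := s) ?_ e he
  · simpa [yAt_val] using this
  · rw [List.pairwise_iff_forall_sublist]
    intro t e hte
    have := h.yAt_origin_le hte
    rw [yAt_val, yAt_val] at this
    simpa using this.trans_lt

lemma sees_iff_of_right (h : T.StackInvariant (v + 1) s) (hv : T.RightReflexAt v) (he : e ∈ s)
    (hlt : (v : ℕ) < e.origin) (hy : T.yAt v ≤ T.yAt e.origin) :
    T.Sees e.origin v ↔ T.rayHeight e (T.xAt v) ≤ T.yAt v := by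
  have hx := ReflexAt.xAt_lt (Or.inr hv) (h.reflexAt e he) hlt
  exact (sees_iff_vis hx).trans (h.vis_iff he hx hy)

lemma rightReflex_sublist (h : T.StackInvariant (v + 1) s) (hv : T.RightReflexAt v)
    (hs : s' <+ s) (hy : ∀ e ∈ s', T.yAt v ≤ T.yAt e.origin)
    (hpair : ∀ t e, [t, e] <+ s' → ¬ (T.Sees t.origin v ∧ T.Sees e.origin v)) :
    T.StackInvariant v s' := by
  have hr : T.ReflexAt v := Or.inr hv
  have hfoot := h.order_foot hv.succ
  have hxe := xAt_even (T := T) hv.1 hv.2.1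
  refine h.advance hs hy (fun h' => by have := h'.1; have := hv.1; omega)
    (fun h' => by have := h'.1; have := hv.1; omega)
    (fun h' => absurd hr h'.not_reflexAt) fun _ => ?_
  rw [List.pairwise_iff_forall_sublist]
  intro t e hte
  have ht := hte.subset (show t ∈ [t, e] by simp)
  have he := hte.subset (show e ∈ [t, e] by simp)
  have hvt := h.le_origin_of_succ (hs.subset ht)
  have hve := hvt.trans_lt (h.pair_lt (hte.trans hs))
  have hfoot' := rel_of_pair_sublist hfoot (hte.trans hs) (T.xAt v) hxe.le
    (xAt_mono hvt (by omega))
  have hlow : T.yAt (v + 1) < T.yAt v := hv.2.2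
  have habove : T.yAt v < T.rayHeight e (T.xAt v) := by
    by_contra hc
    push Not at hc
    refine hpair t e hte ⟨?_, (h.sees_iff_of_right hv (hs.subset he) hve (hy e he)).2 hc⟩
    rcases hvt.eq_or_lt with heq | hlt
    · rw [← Fin.ext heq]
      exact sees_self v
    · refine (h.sees_iff_of_right hv (hs.subset ht) hlt (hy t ht)).2 ?_
      rcases hfoot' with h' | h'
      · exact h'.trans hc
      · exact h'.2.trans hlow.le
  refine ⟨hfoot'.elim id fun h' => h'.2.trans (hlow.trans habove).le, fun k hk hxk => ?_⟩
  exact (hr.yAt_le_of_xAt_eq hk hxk).trans_lt habove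

lemma rightReflex (h : T.StackInvariant (v + 1) s) (hv : T.RightReflexAt v) (hv0 : 0 < (v : ℕ))
    (L : Fin (m + 1) → List (Fin (m + 1))) :
    T.StackInvariant v (T.handleRightReflex v s L).1 := by
  have hr : T.ReflexAt v := Or.inr hv
  set d := s.dropWhile fun e => decide (T.y e.origin < T.y v) with hd
  have hds : d <+ s := List.dropWhile_sublist _
  have hy : ∀ e ∈ d, T.yAt v ≤ T.yAt e.origin := fun e he => h.yAt_le_of_mem_dropWhile he
  -- of two entries that see `v`, the one on the left is deleted
  have hkeep : ∀ s₁ s₂ : List (SweepRay m), s₂ <+ d →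
      (∀ e ∈ s₂, e ∈ T.keepRightmost (fun e => T.Sees e.origin v) s₁) → T.StackInvariant v s₂ := by
    intro s₁ s₂ h2 hmem
    refine h.rightReflex_sublist hv (h2.trans hds) (fun e he => hy e (h2.subset he)) ?_
    rintro t e hte ⟨hst, hse⟩
    have ht := mem_keepRightmost.1 (hmem t (hte.subset (by simp)))
    have he := mem_keepRightmost.1 (hmem e (hte.subset (by simp)))
    exact absurd (h.pair_xAt_lt ((hte.trans h2).trans hds)) (not_lt.2 (ht.2 hst e he.1 hse))
  unfold handleRightReflex
  rcases rightReflexPush_cases (T := T) v s L with ⟨heq, -⟩ | ⟨u, s'', p, hsu, hu, hp, heq⟩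
  · rw [heq]
    exact hkeep d _ List.filter_sublist fun e he => he
  · rw [heq]
    simp only [← hd]
    set a : SweepRay m := ⟨v, ⟨(v : ℕ) - 1, by omega⟩⟩ with ha
    have hud : ∀ e ∈ d, (v : ℕ) < e.origin ∧ T.xAt e.obstacle < T.xAt e.origin := by
      intro e he
      have hue : u ∉ d := fun h' => by
        have := hy u h'
        rw [yAt_val, yAt_val] at this
        exact absurd hu (not_lt.2 this)
      have hes := hds.subset he
      refine ⟨(h.le_origin_of_succ hes).lt_of_ne fun h' => ?_,
        (h.not_vertical e hes).resolve_right fun h' => ?_⟩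
      · -- `v` can be in the stack only together with entries that are not lower
        have hle := h.le_origin e hes
        have hne : e ≠ u := fun h'' => hue (h'' ▸ he)
        rw [hsu, List.mem_cons] at hes
        have hsort := h.sorted
        rw [hsu, List.pairwise_cons] at hsort
        have := hsort.1 e (hes.resolve_left hne)
        have := h.le_origin_of_succ (show u ∈ s by simp [hsu])
        omega
      · have : u ∈ s := by simp [hsu]
        rw [h'.1, List.mem_singleton] at this
        exact hue (this ▸ he)
    rcases keepRightmost_cons (T := T) (fun e => T.Sees e.origin v) a d with ⟨d', hsub, hcons⟩ | hsub
    · have hmem : a ∈ T.keepRightmost (fun e => T.Sees e.origin v) (a :: d) := by simp [hcons]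
      rw [hcons]
      have hinv : T.StackInvariant v d' := hkeep (a :: d) d' hsub fun e he => by
        rw [hcons]; exact List.mem_cons_of_mem _ he
      have hns : ∀ e ∈ d', ¬ T.Sees e.origin v := fun e he hse => by
        have := (mem_keepRightmost.1 hmem).2 (sees_self v) e
          (List.mem_cons_of_mem _ (hsub.subset he)) hse
        exact absurd (hr.xAt_lt (hinv.reflexAt e he) (hud e (hsub.subset he)).1)
          (not_lt.2 this)
      have habove : ∀ e ∈ d', T.yAt v < T.rayHeight e (T.xAt v) := fun e he =>
        not_le.1 fun hc => hns e he ((h.sees_iff_of_right hv (hds.subset (hsub.subset he))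
          (hud e (hsub.subset he)).1 (hy e (hsub.subset he))).2 hc)
      have hx := xAt_odd (T := T) (k := (v : ℕ) - 1) (by have := hv.1; omega) (by omega)
      have hyy := yAt_odd (T := T) (k := (v : ℕ) - 1) (by have := hv.1; omega) (by omega)
      rw [Nat.sub_add_cancel hv0] at hx hyy
      have hsl : T.raySlope a = 0 := by simp [raySlope, slopeAt, ha, hyy]
      refine hinv.push hr (Or.inl le_rfl) (fun e he => (hud e (hsub.subset he)).1)
        (fun k h1 h2 => by rw [le_antisymm h2 h1]) hsl.ge (fun w hw hwv hvis => ?_)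
        (fun k _ _ _ => by omega) (fun e he => (habove e he).le) (Or.inl hx)
        (fun e he => (hud e (hsub.subset he)).2) (fun h' => absurd hr h'.not_reflexAt)
        fun _ _ e he => ⟨?_, fun k hk hxk => (hr.yAt_le_of_xAt_eq hk hxk).trans_lt (habove e he)⟩
      · have := hvis.yAt_ge_of_even hwv hv.1 hv.2.1 (by omega)
        rw [rayHeight, hsl]
        simpa [ha] using this
      · exact (rayHeight_origin (T := T) a).le.trans (habove e he).le
    · exact hkeep (a :: d) _ hsub fun e he => he

end StackInvariant

/-! ### Invariants of the lists -/

/-- The vertex `f` is the first element of one of the lists. -/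
def IsFirst (L : Fin (m + 1) → List (Fin (m + 1))) (f : Fin (m + 1)) : Prop :=
  ∃ g, (L g).head? = some f

lemma IsFirst.exists_mem {L : Fin (m + 1) → List (Fin (m + 1))} {f : Fin (m + 1)}
    (h : IsFirst L f) : ∃ g, f ∈ L g := by
  obtain ⟨g, hg⟩ := h
  exact ⟨g, List.mem_of_mem_head? hg⟩

variable (T) in
/-- The properties of the lists when the vertices with an index at least `N` have been swept:
they partition the left convex ones among these, every vertex is in the list of a reflex vertex
that sees it, and no reflex vertex sees two first elements. -/
structure ListInvariant (N : ℕ) (L : Fin (m + 1) → List (Fin (m + 1))) : Prop where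
  sound : ∀ g w, w ∈ L g → T.ReflexAt g ∧ T.LeftConvexAt w ∧ N ≤ w ∧ T.Sees g w
  complete : ∀ w : Fin (m + 1), T.LeftConvexAt w → N ≤ w → ∃ g, w ∈ L g
  disjoint : ∀ g g' w, w ∈ L g → w ∈ L g' → g = g'
  independent : ∀ r : Fin (m + 1), T.ReflexAt r → ∀ f f', IsFirst L f → IsFirst L f' →
    T.Sees r f → T.Sees r f' → f = f'

variable (T) in
/-- The relation between the stack and the lists when the vertices with an index at least `N` have
been swept.  The field `guard` says that the sweep loses nothing by forgetting all reflex vertices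
that are not in the stack: whatever an earlier reflex vertex can see together with a first element
is seen from the stack.  The field `foot` describes the top of the stack between the two vertices
of a vertical edge going down: the lower one is the last element of its list. -/
structure GuardInvariant (N : ℕ) (s : List (SweepRay m)) (L : Fin (m + 1) → List (Fin (m + 1))) :
    Prop where
  nonempty : ∀ e ∈ s, L e.origin ≠ []
  guard : ∀ f, IsFirst L f → ∀ r : Fin (m + 1), T.ReflexAt r → N ≤ r → T.Sees r f →
    ∀ w : Fin (m + 1), T.LeftConvexAt w → (w : ℕ) < N → T.Sees r w →
      ∃ e ∈ s, T.Sees e.origin w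
  foot : T.LeftConvexAt N → ∃ u s' l, ∃ w : Fin (m + 1), s = u :: s' ∧ (w : ℕ) = N ∧
    L u.origin = l ++ [w] ∧ w ∉ l ∧
      (T.rayHeight u (T.xAt N) ≤ T.yAt N ∨ (u.origin : ℕ) + 1 = N)

variable {N : ℕ} {s s' : List (SweepRay m)} {L : Fin (m + 1) → List (Fin (m + 1))}
  {v r g w h : Fin (m + 1)}

lemma mem_addTo {g' : Fin (m + 1)} :
    w ∈ addTo L g v g' ↔ w ∈ L g' ∨ (g' = g ∧ w = v) := by
  unfold addTo
  by_cases hg : g' = g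
  · subst hg; simp
  · simp [hg]

lemma IsFirst.of_addTo {f : Fin (m + 1)} (hf : IsFirst (addTo L g v) f) :
    IsFirst L f ∨ (f = v ∧ L g = []) := by
  obtain ⟨g', hg'⟩ := hf
  unfold addTo at hg'
  by_cases hg : g' = g
  · subst hg
    rw [Function.update_self] at hg'
    rcases hL : L g' with _ | ⟨a, l⟩
    · rw [hL] at hg'
      simp only [List.nil_append, List.head?_cons, Option.some.injEq] at hg'
      exact Or.inr ⟨hg'.symm, rfl⟩
    · rw [hL] at hg'
      exact Or.inl ⟨g', by rw [hL]; simpa using hg'⟩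
  · rw [Function.update_of_ne hg] at hg'
    exact Or.inl ⟨g', hg'⟩

namespace ListInvariant

lemma advance (hL : T.ListInvariant (v + 1) L) (hv : ¬ T.LeftConvexAt v) :
    T.ListInvariant v L where
  sound g w hw := by
    obtain ⟨h1, h2, h3, h4⟩ := hL.sound g w hw
    exact ⟨h1, h2, by omega, h4⟩
  complete w hw hvw := hL.complete w hw (by
    rcases hvw.eq_or_lt with heq | hlt
    · exact absurd (heq ▸ hw) hv
    · exact hlt)
  disjoint := hL.disjoint
  independent := hL.independent

lemma addTo (hL : T.ListInvariant (v + 1) L) (hv : T.LeftConvexAt v) (hg : T.ReflexAt g)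
    (hgv : T.Sees g v) (hind : L g = [] → ∀ f, IsFirst L f → ∀ r : Fin (m + 1), T.ReflexAt r →
      T.Sees r f → ¬ T.Sees r v) : T.ListInvariant v (addTo L g v) where
  sound g' w hw := by
    rcases mem_addTo.1 hw with hw | ⟨rfl, rfl⟩
    · obtain ⟨h1, h2, h3, h4⟩ := hL.sound g' w hw
      exact ⟨h1, h2, by omega, h4⟩
    · exact ⟨hg, hv, le_rfl, hgv⟩
  complete w hw hvw := by
    rcases hvw.eq_or_lt with heq | hlt
    · exact ⟨g, mem_addTo.2 (Or.inr ⟨rfl, Fin.ext heq.symm⟩)⟩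
    · obtain ⟨g', hg'⟩ := hL.complete w hw hlt
      exact ⟨g', mem_addTo.2 (Or.inl hg')⟩
  disjoint g₁ g₂ w h1 h2 := by
    have hnew : ∀ g', v ∉ L g' := fun g' h' => by
      have := (hL.sound g' v h').2.2.1
      omega
    rcases mem_addTo.1 h1 with k1 | ⟨rfl, rfl⟩
    · rcases mem_addTo.1 h2 with k2 | ⟨rfl, rfl⟩
      · exact hL.disjoint _ _ _ k1 k2
      · exact absurd k1 (hnew _)
    · rcases mem_addTo.1 h2 with k2 | ⟨rfl, -⟩
      · exact absurd k2 (hnew _)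
      · rfl
  independent r hr f f' hf hf' h1 h2 := by
    rcases hf.of_addTo with k | ⟨rfl, hLg⟩
    · rcases hf'.of_addTo with k' | ⟨rfl, hLg⟩
      · exact hL.independent r hr f f' k k' h1 h2
      · exact absurd h2 (hind hLg f k r hr h1)
    · rcases hf'.of_addTo with k' | ⟨rfl, -⟩
      · exact absurd h1 (hind hLg f' k' r hr h2)
      · rfl

/-- Moving the only element of a list to an empty list. -/
lemma move {u p : Fin (m + 1)} (hL : T.ListInvariant N L) (huv : u ≠ v) (hu : L u = [p])
    (hLv : L v = []) (hv : T.ReflexAt v) (hvp : T.Sees v p) :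
    T.ListInvariant N (OrthogonalTerrain.addTo (Function.update L u []) v p) ∧
      ∀ f, IsFirst (OrthogonalTerrain.addTo (Function.update L u []) v p) f → IsFirst L f := by
  have hmem : ∀ g w, w ∈ OrthogonalTerrain.addTo (Function.update L u []) v p g ↔
      (g ≠ u ∧ w ∈ L g) ∨ (g = v ∧ w = p) := by
    intro g w
    rw [mem_addTo]
    by_cases hg : g = u
    · subst hg; simp
    · simp [hg]
  have hfirst : ∀ f, IsFirst (OrthogonalTerrain.addTo (Function.update L u []) v p) f →
      IsFirst L f := by
    intro f hf
    rcases hf.of_addTo with ⟨g, hg⟩ | ⟨rfl, -⟩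
    · by_cases hgu : g = u
      · subst hgu; simp at hg
      · rw [Function.update_of_ne hgu] at hg
        exact ⟨g, hg⟩
    · exact ⟨u, by simp [hu]⟩
  have hpu : p ∈ L u := by simp [hu]
  refine ⟨⟨fun g w hw => ?_, fun w hw hN => ?_, fun g₁ g₂ w h1 h2 => ?_,
    fun r hr f f' hf hf' => hL.independent r hr f f' (hfirst f hf) (hfirst f' hf')⟩, hfirst⟩
  · rcases (hmem g w).1 hw with ⟨-, hw⟩ | ⟨rfl, rfl⟩
    · exact hL.sound g w hw
    · obtain ⟨-, h2, h3, -⟩ := hL.sound u w hpu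
      exact ⟨hv, h2, h3, hvp⟩
  · obtain ⟨g, hg⟩ := hL.complete w hw hN
    by_cases hgu : g = u
    · subst hgu
      rw [hu, List.mem_singleton] at hg
      exact ⟨v, (hmem v w).2 (Or.inr ⟨rfl, hg⟩)⟩
    · exact ⟨g, (hmem g w).2 (Or.inl ⟨hgu, hg⟩)⟩
  · rcases (hmem g₁ w).1 h1 with ⟨hn1, k1⟩ | ⟨rfl, rfl⟩
    · rcases (hmem g₂ w).1 h2 with ⟨-, k2⟩ | ⟨rfl, rfl⟩
      · exact hL.disjoint _ _ _ k1 k2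
      · exact absurd (hL.disjoint _ _ _ k1 hpu) hn1
    · rcases (hmem g₂ w).1 h2 with ⟨hn2, k2⟩ | ⟨rfl, -⟩
      · exact absurd (hL.disjoint _ _ _ k2 hpu) hn2
      · rfl

end ListInvariant

/-! ### The stack dominates the vertices removed from it -/

lemma sees_leftConvex_of_lt (hr : T.ReflexAt r) (hw : T.LeftConvexAt w) (h : (w : ℕ) < r) :
    T.Sees r w ↔ T.Vis w r := by
  rw [sees_leftConvex_iff hr hw]
  exact ⟨fun h' => h'.elim (fun h' => by omega) (·.2), fun h' => Or.inr ⟨h, h'⟩⟩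

lemma sees_of_order (hw : T.LeftConvexAt w) (hwv : (w : ℕ) < v) (hg : T.ReflexAt g)
    (hh : T.ReflexAt h) (hx : T.xAt v < T.xAt g) (hgh : (g : ℕ) < h) (hgw : T.Sees g w)
    (hhv : T.Sees h v) : T.Sees h w := by
  have hvg := lt_of_xAt_lt (by omega) hx
  have hx' := hg.xAt_lt hh hgh
  rw [sees_leftConvex_of_lt hg hw (by omega)] at hgw
  rw [sees_leftConvex_of_lt hh hw (by omega)]
  exact vis_of_order hwv.le hx hx' (by omega) hg.le hh.le hgw
    ((sees_iff_vis (hx.trans hx')).1 hhv)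

lemma sees_of_rightReflex (hw : T.LeftConvexAt w) (hwv : (w : ℕ) < v) (hv : T.RightReflexAt v)
    (hh : T.ReflexAt h) (hvh : (v : ℕ) < h) (hy : T.yAt v ≤ T.yAt h) (hvw : T.Sees v w)
    (hhv : T.Sees h v) : T.Sees h w := by
  have hr : T.ReflexAt v := Or.inr hv
  have hx := xAt_lt_of_lt (T := T) hwv hr.le (Or.inl hw.1)
  have hx' := hr.xAt_lt hh hvh
  rw [sees_leftConvex_of_lt hr hw hwv] at hvw
  rw [sees_leftConvex_of_lt hh hw (by omega)]
  exact vis_trans_of_le hx hx' hr.le hh.le hvw ((sees_iff_vis hx').1 hhv)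
    (hvw.yAt_ge_of_even hx hv.1 hr.le (by omega)) hy

lemma exists_mem_keepRightmost {p : SweepRay m → Prop} {e : SweepRay m} (he : e ∈ s)
    (hne : e ∉ T.keepRightmost p s) :
    p e ∧ ∃ f ∈ T.keepRightmost p s, p f ∧ T.xAt e.origin < T.xAt f.origin := by
  rw [mem_keepRightmost] at hne
  push Not at hne
  obtain ⟨hpe, f₀, hf₀, hpf₀, hlt⟩ := hne he
  have hfin : {f | f ∈ s ∧ p f}.Finite := (List.finite_toSet s).subset fun f hf => hf.1
  obtain ⟨f, ⟨hf, hpf⟩, hmax⟩ := hfin.exists_maximalFor (fun f => T.xAt f.origin) _ ⟨f₀, hf₀, hpf₀⟩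
  have hmax' : ∀ f' ∈ s, p f' → T.xAt f'.origin ≤ T.xAt f.origin := fun f' h1 h2 => by
    rcases le_total (T.xAt f'.origin) (T.xAt f.origin) with h | h
    · exact h
    · exact hmax ⟨h1, h2⟩ h
  exact ⟨hpe, f, mem_keepRightmost.2 ⟨hf, fun _ => hmax'⟩, hpf, hlt.trans_le (hmax' f₀ hf₀ hpf₀)⟩

/-- Of the vertices that see the right reflex vertex `v` and are not lower, the rightmost one
dominates the others. -/
lemma exists_mem_keepRightmost_sees (hv : T.RightReflexAt v)
    (hs : ∀ e ∈ s, T.ReflexAt e.origin ∧ (v : ℕ) ≤ e.origin ∧ T.yAt v ≤ T.yAt e.origin)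
    (hw : T.LeftConvexAt w) (hwv : (w : ℕ) < v) {e : SweepRay m} (he : e ∈ s)
    (hew : T.Sees e.origin w) :
    ∃ f ∈ T.keepRightmost (fun e => T.Sees e.origin v) s, T.Sees f.origin w := by
  by_cases hk : e ∈ T.keepRightmost (fun e => T.Sees e.origin v) s
  · exact ⟨e, hk, hew⟩
  · obtain ⟨-, f, hf, hfv, hlt⟩ := exists_mem_keepRightmost he hk
    refine ⟨f, hf, ?_⟩
    have hr : T.ReflexAt v := Or.inr hv
    obtain ⟨h1, h2, -⟩ := hs e he
    obtain ⟨h4, -, h6⟩ := hs f (mem_keepRightmost.1 hf).1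
    have hef := lt_of_xAt_lt (by omega) hlt
    rcases h2.eq_or_lt with heq | hlt'
    · have heq : e.origin = v := Fin.ext heq.symm
      rw [heq] at hew hef
      exact sees_of_rightReflex hw hwv hv h4 hef h6 hew hfv
    · exact sees_of_order hw hwv h1 h4 (hr.xAt_lt h1 hlt') hef hew hfv

/-! ### The lists at the vertex events -/

namespace StackInvariant

variable {e t : SweepRay m}

/-- The rule for the lists at a left convex vertex `v`, where `a` is the top of the stack after
the update. -/
lemma guard_of_leftConvex (hS : T.StackInvariant (v + 1) s) (hL : T.ListInvariant (v + 1) L)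
    (hG : T.GuardInvariant (v + 1) s L) (hv : T.LeftConvexAt v) {d : List (SweepRay m)}
    {p : SweepRay m → Bool} {a : SweepRay m} (ha : T.ReflexAt a.origin)
    (hav : T.Sees a.origin v)
    (hd : s.dropWhile p = d) (hds : ∀ e ∈ d, e ∈ a :: s')
    (hpop : ∀ e ∈ s.takeWhile p, (e.origin : ℕ) < a.origin)
    (hne : ∀ e ∈ s', L e.origin ≠ [])
    (hnew : L a.origin = [] → T.IsRightHorizon v a.origin ∧ ∀ e ∈ s, ¬ T.Sees e.origin v)
    (hfoot : T.rayHeight a (T.xAt v) ≤ T.yAt v ∨ (a.origin : ℕ) + 1 = v) :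
    T.ListInvariant v (addTo L a.origin v) ∧
      T.GuardInvariant v (a :: s') (addTo L a.origin v) := by
  have hvr : ∀ r : Fin (m + 1), T.ReflexAt r → (v : ℕ) ≤ r → (v : ℕ) + 1 ≤ r := by
    intro r hr hle
    refine hle.lt_of_ne fun heq => ?_
    rw [← heq] at hr
    exact hv.not_reflexAt hr
  have hmem : ∀ f, IsFirst L f → (v : ℕ) + 1 ≤ f ∧ T.LeftConvexAt f := fun f hf => by
    obtain ⟨g, hg⟩ := hf.exists_mem
    exact ⟨(hL.sound g f hg).2.2.1, (hL.sound g f hg).2.1⟩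
  refine ⟨hL.addTo hv ha hav fun hLa f hf r hr hrf hrv => ?_, ?_, ?_, ?_⟩
  · -- a reflex vertex seeing both `v` and `f` would be dominated by an entry of the stack
    have hfv := (hmem f hf).1
    have hrN : (v : ℕ) + 1 ≤ r := by
      rcases (sees_leftConvex_iff hr (hmem f hf).2).1 hrf with h' | h'
      · exact hvr r hr (by omega)
      · have : (f : ℕ) < r := h'.1
        omega
    obtain ⟨e, he, hev⟩ := hG.guard f hf r hr hrN hrf v hv (by omega) hrv
    exact (hnew hLa).2 e he hev
  · intro e he
    unfold addTo
    by_cases hea : e.origin = a.origin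
    · rw [hea, Function.update_self]; simp
    · rw [Function.update_of_ne hea]
      rcases List.mem_cons.1 he with rfl | he
      · exact absurd rfl hea
      · exact hne e he
  · intro f hf r hr hvr' hrf w hw hwv hrw
    have hrN := hvr r hr hvr'
    rcases hf.of_addTo with hf | ⟨rfl, hLa⟩
    · obtain ⟨e, he, hew⟩ := hG.guard f hf r hr hrN hrf w hw (by omega) hrw
      have hsplit : e ∈ s.takeWhile p ++ s.dropWhile p := by
        rwa [List.takeWhile_append_dropWhile]
      rcases List.mem_append.1 hsplit with he' | he'
      · exact ⟨a, List.mem_cons_self, sees_of_order hw hwv (hS.reflexAt e he) ha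
          (hS.xAt_lt_origin hv.1 he) (hpop e he') hew hav⟩
      · exact ⟨e, hds e (hd ▸ he'), hew⟩
    · refine ⟨a, List.mem_cons_self, ?_⟩
      have hle := (hnew hLa).1.2.2 r (isReflex_iff.2 hr) hrf
      rw [← xAt_val, ← xAt_val] at hle
      rcases lt_trichotomy (r : ℕ) a.origin with hlt | heq | hgt
      · exact sees_of_order hw hwv hr ha (xAt_lt_of_lt hrN hr.le (Or.inl hv.1)) hlt hrw hav
      · rwa [← Fin.ext heq]
      · exact absurd (ha.xAt_lt hr hgt) (not_lt.2 hle)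
  · intro _
    refine ⟨a, s', L a.origin, v, rfl, rfl, by simp [addTo], fun h' => ?_, hfoot⟩
    have := (hL.sound _ _ h').2.2.1
    omega

lemma lists_leftConvex (hS : T.StackInvariant (v + 1) s) (hL : T.ListInvariant (v + 1) L)
    (hG : T.GuardInvariant (v + 1) s L) (hv : T.LeftConvexAt v) (hr : T.IsRightHorizon v r) :
    T.ListInvariant v (T.handleLeftConvex v r s L).2 ∧
      T.GuardInvariant v (T.handleLeftConvex v r s L).1 (T.handleLeftConvex v r s L).2 := by
  set p : SweepRay m → Bool :=
    fun e => decide (¬ (T.Sees e.origin v ∨ T.x r < T.x e.origin)) with hp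
  have hsub := List.dropWhile_sublist (l := s) p
  have happ := List.takeWhile_append_dropWhile (p := p) (l := s)
  have hrr := isReflex_iff.1 hr.1
  have hhor : ∀ e ∈ s, T.Sees e.origin v → ¬ T.x r < T.x e.origin := fun e he hev =>
    not_lt.2 (hr.2.2 _ (isReflex_iff.2 (hS.reflexAt e he)) hev)
  rcases handleLeftConvex_cases (T := T) v r s L with ⟨a, s', hd, hav, heq⟩ | ⟨d, hd, hns, heq⟩
  · rw [heq]
    change s.dropWhile p = _ at hd
    have ha : a ∈ s := hsub.subset (by simp [hd])
    refine hS.guard_of_leftConvex hL hG hv (hS.reflexAt a ha) hav hd (fun e he => he) ?_ ?_ ?_ ?_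
    · intro e he
      refine hS.pair_lt (t := e) (e := a) ?_
      rw [← happ]
      exact (List.singleton_sublist.2 he).append (List.singleton_sublist.2 (by simp [hd]))
    · exact fun e he => hG.nonempty e (hsub.subset (by simp [hd, he]))
    · exact fun h' => absurd h' (hG.nonempty a ha)
    · exact Or.inl ((hS.sees_iff hv.1 ha).1 hav)
  · rw [heq]
    change s.dropWhile p = _ at hd
    have hpop : ∀ e ∈ s.takeWhile p, ¬ T.Sees e.origin v ∧ ¬ T.x r < T.x e.origin := fun e he => by
      simpa [hp] using List.mem_takeWhile_imp he
    have hnone : ∀ e ∈ s, ¬ T.Sees e.origin v := by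
      intro e he hev
      rw [← happ, List.mem_append] at he
      rcases he with he | he
      · exact (hpop e he).1 hev
      · rw [hd] at he
        rcases d with _ | ⟨a, d⟩
        · simp at he
        · obtain ⟨h1, h2⟩ := hns a d rfl
          rcases List.mem_cons.1 he with rfl | he'
          · exact h1 hev
          · have hpair : [a, e] <+ s := by
              rw [hd] at hsub
              exact ((List.singleton_sublist.2 he').cons_cons a).trans hsub
            have h3 := hS.pair_xAt_lt hpair
            rw [xAt_val, xAt_val] at h3
            exact hhor e (hpair.subset (by simp)) hev (h2.trans h3)
    refine hS.guard_of_leftConvex (a := ⟨r, v⟩) hL hG hv hrr hr.2.1 hd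
      (fun e he => List.mem_cons_of_mem _ he) ?_ ?_ (fun _ => ⟨hr, hnone⟩) ?_
    · intro e he
      obtain ⟨h1, h2⟩ := hpop e he
      have hes := (List.takeWhile_sublist p).subset he
      refine lt_of_not_ge fun hle => ?_
      rcases hle.eq_or_lt with h' | h'
      · exact h1 (by rw [← Fin.ext h']; exact hr.2.1)
      · have := hrr.xAt_lt (hS.reflexAt e hes) h'
        rw [xAt_val, xAt_val] at this
        exact h2 this
    · exact fun e he => hG.nonempty e (hsub.subset (hd ▸ he))
    · rcases hr.lt_or_eq hv with hlt | ⟨h1, h2⟩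
      · exact Or.inl (rayHeight_mk (xAt_lt_of_lt hlt hrr.le (Or.inl hv.1))).le
      · exact Or.inr (by dsimp only; omega)

lemma lists_leftReflex (hS : T.StackInvariant (v + 1) s) (hL : T.ListInvariant (v + 1) L)
    (hG : T.GuardInvariant (v + 1) s L) (hv : T.LeftReflexAt v) :
    T.ListInvariant v L ∧ T.GuardInvariant v (T.handleLeftReflex v s) L := by
  have hlc : ¬ T.LeftConvexAt v := fun h' => h'.not_reflexAt (Or.inl hv)
  have hfirst : ∀ f, IsFirst L f → (v : ℕ) + 1 ≤ f ∧ T.LeftConvexAt f := fun f hf => by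
    obtain ⟨g, hg⟩ := hf.exists_mem
    exact ⟨(hL.sound g f hg).2.2.1, (hL.sound g f hg).2.1⟩
  set p : SweepRay m → Bool := fun e => decide (T.Sees e.origin v) with hp
  have happ := List.takeWhile_append_dropWhile (p := p) (l := s)
  have horigin : ∀ e ∈ T.handleLeftReflex v s, ∃ e' ∈ s, e'.origin = e.origin := by
    intro e he
    unfold handleLeftReflex at he
    split at he
    · exact ⟨e, he, rfl⟩
    · rename_i a hsome
      rcases List.mem_cons.1 he with rfl | he
      · exact ⟨a, (List.takeWhile_sublist p).subset (List.mem_of_getLast? hsome), rfl⟩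
      · exact ⟨e, (List.dropWhile_sublist p).subset he, rfl⟩
  have hdom : ∀ w : Fin (m + 1), T.LeftConvexAt w → (w : ℕ) < v → ∀ e ∈ s, T.Sees e.origin w →
      ∃ e' ∈ T.handleLeftReflex v s, T.Sees e'.origin w := by
    intro w hw hwv e he hew
    unfold handleLeftReflex
    split
    · exact ⟨e, he, hew⟩
    · rename_i a hsome
      have ha : a ∈ s.takeWhile p := List.mem_of_getLast? hsome
      have has : a ∈ s := (List.takeWhile_sublist p).subset ha
      have hav : T.Sees a.origin v := by simpa [hp] using List.mem_takeWhile_imp ha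
      have he2 := he
      rw [← happ, List.mem_append] at he2
      rcases he2 with he' | he'
      · refine ⟨⟨a.origin, v⟩, List.mem_cons_self, ?_⟩
        have hlast := List.dropLast_append_getLast? a hsome
        change (s.takeWhile p).dropLast ++ [a] = s.takeWhile p at hlast
        rw [← hlast, List.mem_append, List.mem_singleton] at he'
        rcases he' with he' | rfl
        · have hpair : [e, a] <+ s := by
            refine List.Sublist.trans ?_ (List.takeWhile_sublist p)
            rw [← hlast]
            exact (List.singleton_sublist.2 he').append (List.Sublist.refl _)
          exact sees_of_order (h := a.origin) hw hwv (hS.reflexAt e he) (hS.reflexAt a has)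
            (hS.xAt_lt_origin hv.1 he) (hS.pair_lt hpair) hew hav
        · exact hew
      · exact ⟨e, List.mem_cons_of_mem _ he', hew⟩
  refine ⟨hL.advance hlc, fun e he => ?_, fun f hf r hr hvr hrf w hw hwv hrw => ?_,
    fun h' => absurd h' hlc⟩
  · obtain ⟨e', he', heq⟩ := horigin e he
    rw [← heq]
    exact hG.nonempty e' he'
  · have hrN : (v : ℕ) + 1 ≤ r := by
      obtain ⟨h1, h2⟩ := hfirst f hf
      have h3 := h2.1
      have h4 := hv.1
      rcases (sees_leftConvex_iff hr h2).1 hrf with h' | h'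
      · omega
      · have : (f : ℕ) < r := h'.1
        omega
    obtain ⟨e, he, hew⟩ := hG.guard f hf r hr hrN hrf w hw (by omega) hrw
    exact hdom w hw hwv e he hew

lemma lists_rightConvex (hL : T.ListInvariant (v + 1) L)
    (hG : T.GuardInvariant (v + 1) s L) (hv : T.RightConvexAt v) :
    T.ListInvariant v L ∧ T.GuardInvariant v s L := by
  have hlc : ¬ T.LeftConvexAt v := fun h' => by have := h'.1; have := hv.1; omega
  refine ⟨hL.advance hlc, hG.nonempty, fun f hf r hr hvr hrf w hw hwv hrw => ?_,
    fun h' => absurd h' hlc⟩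
  have hrN : (v : ℕ) + 1 ≤ r := by
    refine hvr.lt_of_ne fun heq => ?_
    rw [← heq] at hr
    exact hv.not_reflexAt hr
  exact hG.guard f hf r hr hrN hrf w hw (by omega) hrw

lemma lists_rightReflex (hS : T.StackInvariant (v + 1) s) (hL : T.ListInvariant (v + 1) L)
    (hG : T.GuardInvariant (v + 1) s L) (hv : T.RightReflexAt v) :
    T.ListInvariant v (T.handleRightReflex v s L).2 ∧
      T.GuardInvariant v (T.handleRightReflex v s L).1 (T.handleRightReflex v s L).2 := by
  have hlc : ¬ T.LeftConvexAt v := fun h' => h'.not_reflexAt (Or.inr hv)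
  have hr : T.ReflexAt v := Or.inr hv
  obtain ⟨u, s₀, l, f₀, hsu, hf₀, hLu, hfl, hu⟩ := hG.foot hv.succ
  have hus : u ∈ s := by simp [hsu]
  have hf₀u : f₀ ∈ L u.origin := by simp [hLu]
  set d := s.dropWhile fun e => decide (T.y e.origin < T.y v) with hd
  have hds : d <+ s := List.dropWhile_sublist _
  have hdy : ∀ e ∈ d, T.ReflexAt e.origin ∧ (v : ℕ) ≤ e.origin ∧ T.yAt v ≤ T.yAt e.origin :=
    fun e he => ⟨hS.reflexAt e (hds.subset he), hS.le_origin_of_succ (hds.subset he),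
      hS.yAt_le_of_mem_dropWhile he⟩
  -- an entry that is lower than `v` sees nothing to the left of `v`
  have hmemd : ∀ w : Fin (m + 1), T.LeftConvexAt w → (w : ℕ) < v → ∀ e ∈ s,
      T.Sees e.origin w → e ∈ d := by
    intro w hw hwv e he hew
    have hle := hS.le_origin_of_succ he
    have hy : T.yAt v ≤ T.yAt e.origin := by
      rw [sees_leftConvex_of_lt (hS.reflexAt e he) hw (by omega)] at hew
      exact hew.yAt_le_of_mem hw.1 (by omega) (hS.reflexAt e he).le hwv.le hle
    rw [← List.takeWhile_append_dropWhile (p := fun e : SweepRay m =>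
      decide (T.y e.origin < T.y v)) (l := s), List.mem_append] at he
    refine he.resolve_left fun h' => ?_
    have := List.mem_takeWhile_imp h'
    rw [yAt_val, yAt_val] at hy
    simp only [decide_eq_true_eq] at this
    exact absurd this (not_lt.2 hy)
  -- if the foot `f₀` of the edge at `v` is a first element, then it is alone in its list
  have htop : IsFirst L f₀ → l = [] := by
    rintro ⟨g, hg⟩
    have : g = u.origin := hL.disjoint _ _ _ (List.mem_of_mem_head? hg) hf₀u
    rw [this, hLu] at hg
    rcases l with _ | ⟨a, l⟩
    · rfl
    · simp only [List.cons_append, List.head?_cons, Option.some.injEq] at hg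
      exact absurd (by simp [hg]) hfl
  have husee : ¬ T.y u.origin < T.y v → T.Sees u.origin v := by
    intro hy
    have hy' : T.yAt v ≤ T.yAt u.origin := by rw [yAt_val, yAt_val]; exact not_lt.1 hy
    rcases (hS.le_origin_of_succ hus).eq_or_lt with heq | hlt
    · rw [← Fin.ext heq]
      exact sees_self v
    · refine (hS.sees_iff_of_right hv hus hlt hy').2 ?_
      have := hu.resolve_right (by omega)
      rw [xAt_even hv.1 hv.2.1] at this
      exact this.trans hv.2.2.le
  -- an old top that is not lower than `v` makes `v` dispensable
  have hudom : ∀ w : Fin (m + 1), T.LeftConvexAt w → (w : ℕ) < v → T.Sees v w →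
      ¬ T.y u.origin < T.y v → T.Sees u.origin w := by
    intro w hw hwv hvw hy
    have hy' : T.yAt v ≤ T.yAt u.origin := by rw [yAt_val, yAt_val]; exact not_lt.1 hy
    rcases (hS.le_origin_of_succ hus).eq_or_lt with heq | hlt
    · rwa [← Fin.ext heq]
    · exact sees_of_rightReflex hw hwv hv (hS.reflexAt u hus) hlt hy' hvw (husee hy)
  -- the foot of its edge is the only swept left convex vertex that `v` sees
  have hcase : ∀ f, IsFirst L f → ∀ r : Fin (m + 1), T.ReflexAt r → (v : ℕ) ≤ r → T.Sees r f →
      (v : ℕ) + 1 ≤ r ∨ (r = v ∧ f = f₀) := by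
    intro f hf r hr' hvr hrf
    obtain ⟨g, hg⟩ := hf.exists_mem
    obtain ⟨-, h2, h3, -⟩ := hL.sound g f hg
    rcases (sees_leftConvex_iff hr' h2).1 hrf with h' | h'
    · rcases hvr.eq_or_lt with heq | hlt
      · exact Or.inr ⟨Fin.ext heq.symm, Fin.ext (by omega)⟩
      · exact Or.inl hlt
    · have : (f : ℕ) < r := h'.1
      exact Or.inl (by omega)
  unfold handleRightReflex
  rcases rightReflexPush_cases (T := T) v s L with ⟨heq, hno⟩ | ⟨u', s'', q, hsu', hlow, hp, heq⟩
  · rw [heq]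
    simp only [← hd]
    refine ⟨hL.advance hlc, fun e he => hG.nonempty e (hds.subset (mem_keepRightmost.1 he).1),
      fun f hf r hr' hvr hrf w hw hwv hrw => ?_, fun h' => absurd h' hlc⟩
    rcases hcase f hf r hr' hvr hrf with hrN | ⟨rfl, rfl⟩
    · obtain ⟨e, he, hew⟩ := hG.guard f hf r hr' hrN hrf w hw (by omega) hrw
      exact exists_mem_keepRightmost_sees hv hdy hw hwv (hmemd w hw hwv e he hew) hew
    · have hnl : ¬ T.y u.origin < T.y r := fun h' => hno u s₀ hsu h' f (by
        rw [hLu, htop hf]; rfl)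
      have hew := hudom w hw hwv hrw hnl
      exact exists_mem_keepRightmost_sees hv hdy hw hwv (hmemd w hw hwv u hus hew) hew
  · rw [heq]
    obtain ⟨rfl, -⟩ : u = u' ∧ s₀ = s'' := by
      rw [hsu, List.cons.injEq] at hsu'; exact hsu'
    have huv : u.origin ≠ v := fun h' => by rw [h'] at hlow; exact lt_irrefl _ hlow
    have hq : q = f₀ := by
      rw [hp, List.mem_singleton] at hf₀u
      exact hf₀u.symm
    have hLv : L v = [] := by
      rw [List.eq_nil_iff_forall_not_mem]
      intro f hf
      obtain ⟨-, h2, h3, h4⟩ := hL.sound v f hf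
      have hff : f = f₀ := by
        rcases (sees_leftConvex_iff hr h2).1 h4 with h' | h'
        · exact Fin.ext (by omega)
        · have : (f : ℕ) < v := h'.1
          omega
      exact huv (hL.disjoint _ _ _ hf₀u (hff ▸ hf))
    obtain ⟨hL', hfirst⟩ := hL.move huv hp hLv hr
      (hq ▸ sees_of_vertical hf₀ hv.1)
    simp only [← hd]
    set a : SweepRay m := ⟨v, ⟨(v : ℕ) - 1, by omega⟩⟩ with ha
    have hady : ∀ e ∈ a :: d, T.ReflexAt e.origin ∧ (v : ℕ) ≤ e.origin ∧
        T.yAt v ≤ T.yAt e.origin :=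
      List.forall_mem_cons.2 ⟨⟨hr, le_rfl, le_rfl⟩, hdy⟩
    refine ⟨hL'.advance hlc, fun e he => ?_, fun f hf r hr' hvr hrf w hw hwv hrw => ?_,
      fun h' => absurd h' hlc⟩
    · unfold addTo
      by_cases hev : e.origin = v
      · rw [hev, Function.update_self]; simp
      · have hed : e ∈ d := by
          refine (List.mem_cons.1 (mem_keepRightmost.1 he).1).resolve_left fun h' => hev ?_
          rw [h']
        have heu : e.origin ≠ u.origin := fun h' => by
          have := (hdy e hed).2.2
          rw [h', yAt_val, yAt_val] at this
          exact absurd hlow (not_lt.2 this)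
        rw [Function.update_of_ne hev, Function.update_of_ne heu]
        exact hG.nonempty e (hds.subset hed)
    · rcases hcase f (hfirst f hf) r hr' hvr hrf with hrN | ⟨rfl, rfl⟩
      · obtain ⟨e, he, hew⟩ := hG.guard f (hfirst f hf) r hr' hrN hrf w hw (by omega) hrw
        exact exists_mem_keepRightmost_sees hv hady hw hwv
          (List.mem_cons_of_mem _ (hmemd w hw hwv e he hew)) hew
      · exact exists_mem_keepRightmost_sees hv hady hw hwv List.mem_cons_self hrw

end StackInvariant

/-! ### Intersection events -/

lemma pair_sublist_of_mem_adjacentCrossings {t : SweepRay m × SweepRay m}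
    (ht : t ∈ T.adjacentCrossings s) : [t.1, t.2] <+ s :=
  ht.1.sublist

lemma finite_adjacentCrossings (s : List (SweepRay m)) : (T.adjacentCrossings s).Finite := by
  refine ((List.finite_toSet s).prod (List.finite_toSet s)).subset fun t ht => ?_
  have := pair_sublist_of_mem_adjacentCrossings ht
  exact ⟨this.subset (by simp), this.subset (by simp)⟩

namespace StackInvariant

variable {e t : SweepRay m}

lemma crossAt_unique (hS : T.StackInvariant N s) {t : SweepRay m × SweepRay m}
    (ht : t ∈ T.adjacentCrossings s) {z z' : ℝ × ℝ} (hz : T.CrossAt t.1 t.2 z)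
    (hz' : T.CrossAt t.1 t.2 z') : z = z' := by
  obtain ⟨h1, h2⟩ := hS.pair_not_vertical (pair_sublist_of_mem_adjacentCrossings ht)
  obtain ⟨hne, -, -, ha, hb⟩ := (crossAt_iff h1 h2).1 hz
  obtain ⟨-, -, -, ha', hb'⟩ := (crossAt_iff h1 h2).1 hz'
  have hx : z.1 = z'.1 := by
    have h3 : (T.raySlope t.1 - T.raySlope t.2) * (z.1 - z'.1) = 0 := by
      simp only [rayHeight] at ha hb ha' hb'
      linear_combination hb - hb' - ha + ha'
    rcases mul_eq_zero.1 h3 with h4 | h4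
    · exact absurd (sub_eq_zero.1 h4) hne
    · exact sub_eq_zero.1 h4
  exact Prod.ext hx (by rw [ha, ha', hx])

lemma not_vertical_of_pair (hS : T.StackInvariant N s) {t : SweepRay m × SweepRay m}
    (ht : t ∈ T.adjacentCrossings s) (he : e ∈ s) :
    T.xAt e.obstacle < T.xAt e.origin := by
  refine (hS.not_vertical e he).resolve_right fun h' => ?_
  have := (pair_sublist_of_mem_adjacentCrossings ht).length_le
  rw [h'.1] at this
  simp at this

/-- Where several rays meet above the terrain at or to the right of the next vertex, the rightmost
of their origins dominates the others. -/
lemma exists_sees_of_crossing (hS : T.StackInvariant (v + 1) s) {z : ℝ × ℝ}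
    (hz : T.StrictlyAbove z) (hvz : T.xAt v ≤ z.1)
    (hnv : ∀ e ∈ s, T.xAt e.obstacle < T.xAt e.origin) (hw : T.LeftConvexAt w)
    (hwv : (w : ℕ) < v + 1) (he : e ∈ s) (hew : T.Sees e.origin w) :
    ∃ f ∈ T.keepRightmost (fun e => z ∈ T.rayPoints e) s, T.Sees f.origin w := by
  by_cases hk : e ∈ T.keepRightmost (fun e => z ∈ T.rayPoints e) s
  · exact ⟨e, hk, hew⟩
  obtain ⟨hez, f, hf, hfz, hlt⟩ := exists_mem_keepRightmost he hk
  refine ⟨f, hf, ?_⟩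
  have hfs := (mem_keepRightmost.1 hf).1
  have hre := hS.reflexAt e he
  have hrf := hS.reflexAt f hfs
  have hpair := hS.pair_sublist he hfs (lt_of_xAt_lt hre.le hlt)
  have hlt' := hS.pair_lt hpair
  obtain ⟨hz1, hz2⟩ := (mem_rayPoints_iff (hnv e he)).1 hez
  obtain ⟨-, hz3⟩ := (mem_rayPoints_iff (hnv f hfs)).1 hfz
  have hz1' : z.1 < T.xAt e.origin := by
    refine hz1.lt_of_ne fun heq => ?_
    have := hz.yAt_lt hre.le heq.symm
    rw [hz2, heq, rayHeight_origin] at this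
    exact lt_irrefl _ this
  have hwe : (w : ℕ) < e.origin := by
    have := hw.1
    have := T.odd_card
    rcases hS.le_origin e he with h' | h' <;> omega
  have hwz : T.xAt w ≤ z.1 := (xAt_mono (by omega) (by omega)).trans hvz
  have hunder := rel_of_pair_sublist hS.under hpair
  rw [sees_leftConvex_of_lt hre hw hwe] at hew
  rw [sees_leftConvex_of_lt hrf hw (hwe.trans hlt')]
  have hxwe := hwz.trans_lt hz1'
  refine vis_glue hxwe hlt hre.le hrf.le hew (s := T.raySlope f) ?_ ?_
  · refine le_trans ?_ (hS.below e he w hwv hxwe hew)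
    refine affine_le_of_le_left hwz hz1' (hz3.symm.trans hz2).le ?_
    exact (rayHeight_origin (T := T) e).le.trans hunder
  · refine yAt_le_line_of_leftReflex hrf.le (hS.slope_nonneg f hfs) hunder fun k hk hek hkf => ?_
    refine hS.clear f hfs k hk ?_ hkf
    rcases hS.le_origin e he with h' | h' <;> omega

/-- Between the two vertices of a vertical edge going down, no rays are left that cross above the
terrain to the right of this edge. -/
lemma crossing_le_of_foot (hS : T.StackInvariant N s) (hN : T.LeftConvexAt N)
    {t : SweepRay m × SweepRay m} (ht : t ∈ T.adjacentCrossings s) {z : ℝ × ℝ}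
    (hz : T.CrossAt t.1 t.2 z) (habove : T.StrictlyAbove z) : z.1 ≤ T.xAt N := by
  have hpair := pair_sublist_of_mem_adjacentCrossings ht
  have hm := T.odd_card
  obtain ⟨h1, h2⟩ := hS.pair_not_vertical hpair
  obtain ⟨hne, hz1, hz2, ha, hb⟩ := (crossAt_iff h1 h2).1 hz
  by_contra hc
  push Not at hc
  have hunder := rel_of_pair_sublist hS.under hpair
  rw [← rayHeight_origin t.1] at hunder
  have hlt : ∀ a, a < z.1 → T.rayHeight t.2 a < T.rayHeight t.1 a := by
    intro a haz
    simp only [rayHeight] at *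
    have : T.raySlope t.1 < T.raySlope t.2 := by
      refine lt_of_le_of_ne ?_ hne
      by_contra hc'
      push Not at hc'
      nlinarith
    nlinarith
  have hfoot : ∀ a, T.xAt N ≤ a → a < z.1 → a < T.xAt (N + 1) ∧ T.rayHeight t.1 a ≤ T.yAt N :=
    fun a ha1 ha2 => (rel_of_pair_sublist (hS.order_foot hN) hpair a ha1
      (ha2.le.trans hz1.le)).resolve_left (not_le.2 (hlt a ha2))
  have hNm : N < m := by
    refine hN.2.1.lt_of_ne fun heq => ?_
    have := xAt_mono (T := T) (k := t.1.origin) (l := N) (by omega) hN.2.1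
    linarith
  have hz4 : z.1 ≤ T.xAt (N + 1) := by
    by_contra hc'
    push Not at hc'
    exact lt_irrefl _ (hfoot _ (xAt_mono (by omega) hNm) hc').1
  have hup : T.yAt N < T.rayHeight t.1 z.1 := by
    rw [← ha]
    exact habove.yAt_lt_of_plateau hN.1 hNm hc.le hz4
  -- the rays are out of order just to the left of `z`, where they are still above the plateau
  have hcont : ContinuousAt (T.rayHeight t.1) z.1 := by
    unfold rayHeight; fun_prop
  obtain ⟨a, ha1, ha2, ha3⟩ := (((hcont.eventually (lt_mem_nhds hup)).filter_mono
    nhdsWithin_le_nhds).and (Ioo_mem_nhdsLT hc)).exists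
  exact absurd ha1 (not_lt.2 (hfoot a ha2.le ha3).2)

lemma handleIntersection (hS : T.StackInvariant N s) (z : ℝ × ℝ) :
    T.StackInvariant N (T.handleIntersection z s) := by
  unfold OrthogonalTerrain.handleIntersection
  split_ifs
  · exact hS.sublist List.filter_sublist
  · exact hS

lemma guard_handleIntersection (hS : T.StackInvariant (v + 1) s)
    (hG : T.GuardInvariant (v + 1) s L) {t : SweepRay m × SweepRay m}
    (ht : t ∈ T.adjacentCrossings s) {z : ℝ × ℝ} (hz : T.CrossAt t.1 t.2 z)
    (hvz : T.xAt v ≤ z.1) : T.GuardInvariant (v + 1) (T.handleIntersection z s) L := by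
  unfold OrthogonalTerrain.handleIntersection
  split_ifs with habove
  swap
  · exact hG
  have hnv : ∀ e ∈ s, T.xAt e.obstacle < T.xAt e.origin := fun e he =>
    hS.not_vertical_of_pair ht he
  refine ⟨fun e he => hG.nonempty e (mem_keepRightmost.1 he).1,
    fun f hf r hr hvr hrf w hw hwv hrw => ?_, fun hN => ?_⟩
  · obtain ⟨e, he, hew⟩ := hG.guard f hf r hr hvr hrf w hw hwv hrw
    exact hS.exists_sees_of_crossing habove hvz hnv hw hwv he hew
  · obtain ⟨u, s₀, l, w, hsu, hw, hLu, hwl, hu⟩ := hG.foot hN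
    have hus : u ∈ s := by simp [hsu]
    have hxv : T.xAt (v + 1) = T.xAt v := xAt_even (by have := hN.1; omega) (by omega)
    have hzx : z.1 = T.xAt v :=
      le_antisymm ((hS.crossing_le_of_foot hN ht hz habove).trans hxv.le) hvz
    have hzu : z ∉ T.rayPoints u := by
      intro h'
      have h3 := ((mem_rayPoints_iff (hnv u hus)).1 h').2
      rcases hu with hu | hu
      · have h4 := habove.yAt_lt (k := v + 1) hN.2.1 (hxv.trans hzx.symm)
        rw [h3, hzx, ← hxv] at h4
        exact absurd h4 (not_lt.2 hu)
      · have huv : u.origin = v := Fin.ext (by omega)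
        have h4 := habove.yAt_lt (k := v) (by omega) hzx.symm
        rw [h3, hzx, ← huv, rayHeight_origin] at h4
        exact lt_irrefl _ h4
    rcases keepRightmost_cons (T := T) (fun e => z ∈ T.rayPoints e) u s₀ with ⟨d, -, hd⟩ | hd
    · exact ⟨u, d, l, w, by rw [hsu, hd], hw, hLu, hwl, hu⟩
    · have hmem : u ∈ T.keepRightmost (fun e => z ∈ T.rayPoints e) (u :: s₀) :=
        mem_keepRightmost.2 ⟨List.mem_cons_self, fun h' => absurd h' hzu⟩
      have hsort := hS.sorted
      rw [hsu, List.pairwise_cons] at hsort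
      exact absurd (hsort.1 u (hd.subset hmem)) (lt_irrefl _)

end StackInvariant

/-! ### The invariant of the sweep -/

variable (T) in
/-- The invariant of the sweep.  `N` is the number of unswept vertices.  When the last vertex has
been swept, only the lists matter. -/
def SweepInvariant (S : SweepState m) : Prop :=
  ∃ N ≤ m + 1, S.events.map (fun v : Fin (m + 1) => (v : ℕ)) = (List.range N).reverse ∧
    T.ListInvariant N S.lists ∧ (0 < N → T.StackInvariant N S.stack ∧
      T.GuardInvariant N S.stack S.lists ∧ S.pending ⊆ T.adjacentCrossings S.stack ∧
      ∀ t ∈ T.adjacentCrossings S.stack, ∀ z, T.CrossAt t.1 t.2 z → T.StrictlyAbove z →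
        t ∈ S.pending)

lemma sweepInvariant_initState : T.SweepInvariant (initState m) := by
  have hfirst : ∀ f : Fin (m + 1), ¬ IsFirst (fun _ => []) f := by
    rintro f ⟨g, hg⟩; simp at hg
  refine ⟨m + 1, le_rfl, ?_, ⟨by simp [initState], fun w _ hw => by omega, by simp [initState],
    fun r _ f f' hf => absurd hf (hfirst f)⟩, fun _ => ⟨StackInvariant.nil, ⟨by simp [initState],
    fun f hf => absurd hf (hfirst f), fun hN => by have := hN.2.1; omega⟩, by simp [initState], ?_⟩⟩
  · simp [initState, List.map_reverse]
  · intro t ht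
    have := (pair_sublist_of_mem_adjacentCrossings ht).length_le
    simp [initState] at this

lemma SweepInvariant.cons {S : SweepState m} (hS : T.SweepInvariant S)
    {vs : List (Fin (m + 1))} (hv : S.events = v :: vs) :
    vs.map (fun v : Fin (m + 1) => (v : ℕ)) = (List.range v).reverse ∧
    T.ListInvariant (v + 1) S.lists ∧ T.StackInvariant (v + 1) S.stack ∧
      T.GuardInvariant (v + 1) S.stack S.lists ∧ S.pending ⊆ T.adjacentCrossings S.stack ∧
      ∀ t ∈ T.adjacentCrossings S.stack, ∀ z, T.CrossAt t.1 t.2 z → T.StrictlyAbove z →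
        t ∈ S.pending := by
  obtain ⟨N, -, hN, hL, hrest⟩ := hS
  rw [hv] at hN
  rcases N with _ | N
  · simp at hN
  · rw [List.range_succ, List.reverse_append, List.map_cons] at hN
    simp only [List.reverse_singleton, List.singleton_append, List.cons.injEq] at hN
    obtain ⟨rfl, hvs⟩ := hN
    exact ⟨hvs, hL, hrest (by omega)⟩

/-- Adjacent crossings above the terrain that do not arise from a change of the stack are already
pending, and those that do are inserted. -/
lemma mem_refresh {H : Set (SweepRay m × SweepRay m)} {t : SweepRay m × SweepRay m}
    (ht : t ∈ T.adjacentCrossings s') (hH : t ∈ T.adjacentCrossings s → t ∈ H) :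
    t ∈ T.refresh H s s' :=
  ⟨ht, (em _).imp_left hH⟩

lemma SweepInvariant.step {S S' : SweepState m} (hS : T.SweepInvariant S) (h : T.Step S S') :
    T.SweepInvariant S' := by
  cases h with
  | vertexEvent v vs s' L' hv hmax hupd =>
    obtain ⟨hvs, hL, hSt, hG, hsub, hpend⟩ := hS.cons hv
    have hcr : ∀ t ∈ T.adjacentCrossings S.stack, ∀ z, T.CrossAt t.1 t.2 z →
        T.StrictlyAbove z → z.1 ≤ T.xAt v := fun t ht z hz habove => by
      rw [xAt_val]
      exact hmax t (hpend t ht z hz habove) z hz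
    suffices T.ListInvariant v L' ∧ (0 < (v : ℕ) → T.StackInvariant v s') ∧
        T.GuardInvariant v s' L' by
      refine ⟨v, by omega, hvs, this.1, fun h0 => ⟨this.2.1 h0, this.2.2, fun t ht => ht.1,
        fun t ht z hz habove => mem_refresh ht fun h' => hpend t h' z hz habove⟩⟩
    generalize S.stack = s at *
    generalize S.lists = L at *
    cases hupd with
    | leftConvex r _ _ hl hc hr =>
      have hlc := leftConvexAt_iff.2 ⟨hl, hc⟩
      have := hSt.lists_leftConvex hL hG hlc hr
      exact ⟨this.1, fun _ => hSt.leftConvex hlc hr L hcr, this.2⟩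
    | rightConvex _ _ hl hc =>
      have hrc := rightConvexAt_iff.2 ⟨hl, hc⟩
      have := StackInvariant.lists_rightConvex hL hG hrc
      exact ⟨this.1, fun _ => hSt.rightConvex hrc, this.2⟩
    | leftReflex _ _ hl hc =>
      have hlr := leftReflexAt_iff.2 ⟨hl, hc⟩
      have := hSt.lists_leftReflex hL hG hlr
      exact ⟨this.1, fun _ => hSt.leftReflex hlr hcr, this.2⟩
    | rightReflex _ _ hl hc =>
      have hrr := rightReflexAt_iff.2 ⟨hl, hc⟩
      have := hSt.lists_rightReflex hL hG hrr
      exact ⟨this.1, fun h0 => hSt.rightReflex hrr h0 L, this.2⟩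
  | intersectionEvent v vs t z hv ht hz hvz hmax =>
    obtain ⟨hvs, hL, hSt, hG, hsub, hpend⟩ := hS.cons hv
    rw [← xAt_val] at hvz
    refine ⟨v + 1, by omega, ?_, hL, fun _ => ⟨hSt.handleIntersection z,
      hSt.guard_handleIntersection hG (hsub ht) hz hvz, fun t' ht' => ht'.1,
      fun t' ht' z' hz' habove => mem_refresh ht' fun h' => ⟨hpend t' h' z' hz' habove, ?_⟩⟩⟩
    · dsimp only
      rw [hv, List.map_cons, hvs, List.range_succ, List.reverse_append]
      rfl
    · -- of the two rays that cross at `z`, only one is kept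
      rintro rfl
      obtain rfl := hSt.crossAt_unique h' hz hz'
      have hpair := pair_sublist_of_mem_adjacentCrossings ht'
      unfold handleIntersection at hpair
      rw [if_pos habove] at hpair
      have h1 := mem_keepRightmost.1 (hpair.subset (show t'.1 ∈ [t'.1, t'.2] by simp))
      have h2 := mem_keepRightmost.1 (hpair.subset (show t'.2 ∈ [t'.1, t'.2] by simp))
      have h3 := hSt.pair_xAt_lt (pair_sublist_of_mem_adjacentCrossings h')
      exact absurd h3 (not_lt.2 (h1.2 hz.2.1 _ h2.1 hz.2.2.1))

lemma Reachable.sweepInvariant {S : SweepState m} (h : T.Reachable S) : T.SweepInvariant S := by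
  induction h with
  | refl => exact sweepInvariant_initState
  | tail _ hstep ih => exact ih.step hstep

/-! ### Termination and progress -/

/-- The termination measure of the sweep. -/
noncomputable def sweepMeasure (S : SweepState m) : ℕ ×ₗ ℕ ×ₗ ℕ :=
  toLex (S.events.length, toLex (S.stack.length, S.pending.ncard))

lemma SweepInvariant.measure_lt {S S' : SweepState m} (hS : T.SweepInvariant S)
    (h : T.Step S S') : sweepMeasure S' < sweepMeasure S := by
  cases h with
  | vertexEvent v vs s' L' hv hmax hupd =>
    refine Prod.Lex.toLex_lt_toLex.2 (Or.inl ?_)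
    simp [hv]
  | intersectionEvent v vs t z hv ht hz hvz hmax =>
    obtain ⟨-, -, -, -, hsub, -⟩ := hS.cons hv
    have hfin : S.pending.Finite := (finite_adjacentCrossings _).subset hsub
    have hsl : T.handleIntersection z S.stack <+ S.stack := by
      unfold handleIntersection
      split_ifs
      · exact List.filter_sublist
      · exact List.Sublist.refl _
    refine Prod.Lex.toLex_lt_toLex.2 (Or.inr ⟨rfl, Prod.Lex.toLex_lt_toLex.2 ?_⟩)
    rcases hsl.length_le.lt_or_eq with hlt | heq
    · exact Or.inl hlt
    · refine Or.inr ⟨heq, Set.ncard_lt_ncard ⟨?_, ?_⟩ hfin⟩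
      · intro t' ht'
        rw [hsl.eq_of_length heq] at ht'
        exact (ht'.2.resolve_right fun h' => h' ht'.1).1
      · intro h'
        have ht' := h' ht
        dsimp only at ht'
        rw [hsl.eq_of_length heq] at ht'
        exact (ht'.2.resolve_right fun h' => h' ht'.1).2 rfl

lemma exists_isRightHorizon (hv : T.LeftConvexAt v) : ∃ r, T.IsRightHorizon v r := by
  have h1 := hv.1
  have hne : (Finset.univ.filter fun g => T.IsReflex g ∧ T.Sees g v).Nonempty := by
    refine ⟨⟨v - 1, by omega⟩, Finset.mem_filter.2 ⟨Finset.mem_univ _, isReflex_iff.2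
      (Or.inr hv.pred), sees_of_vertical ?_ ?_⟩⟩
    · dsimp only; omega
    · dsimp only; omega
  obtain ⟨r, hr, hmax⟩ := Finset.exists_max_image _ T.x hne
  simp only [Finset.mem_filter, Finset.mem_univ, true_and] at hr hmax
  exact ⟨r, hr.1, hr.2, fun g h1 h2 => hmax g ⟨h1, h2⟩⟩

lemma exists_vertexUpdate (v : Fin (m + 1)) (s : List (SweepRay m))
    (L : Fin (m + 1) → List (Fin (m + 1))) : ∃ s' L', T.VertexUpdate v s L s' L' := by
  rcases vertex_cases (T := T) (k := v) (by omega) with h | h | h | h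
  · obtain ⟨r, hr⟩ := exists_isRightHorizon h
    obtain ⟨h1, h2⟩ := leftConvexAt_iff.1 h
    exact ⟨_, _, .leftConvex v r s L h1 h2 hr⟩
  · obtain ⟨h1, h2⟩ := leftReflexAt_iff.1 h
    exact ⟨_, _, .leftReflex v s L h1 h2⟩
  · obtain ⟨h1, h2⟩ := rightConvexAt_iff.1 h
    exact ⟨_, _, .rightConvex v s L h1 h2⟩
  · obtain ⟨h1, h2⟩ := rightReflexAt_iff.1 h
    exact ⟨_, _, .rightReflex v s L h1 h2⟩

lemma SweepInvariant.exists_step {S : SweepState m} (hS : T.SweepInvariant S)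
    (hne : S.events ≠ []) : ∃ S', T.Step S S' := by
  obtain ⟨v, vs, hv⟩ := List.exists_cons_of_ne_nil hne
  obtain ⟨-, -, hSt, -, hsub, -⟩ := hS.cons hv
  by_cases hall : ∀ t ∈ S.pending, ∀ z, T.CrossAt t.1 t.2 z → z.1 ≤ T.x v
  · obtain ⟨s', L', hupd⟩ := exists_vertexUpdate (T := T) v S.stack S.lists
    exact ⟨_, .vertexEvent S v vs s' L' hv hall hupd⟩
  · push Not at hall
    obtain ⟨t₀, ht₀, z₀, hz₀, hlt⟩ := hall
    have hfin : S.pending.Finite := (finite_adjacentCrossings _).subset hsub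
    have hex : ∀ t ∈ S.pending, ∃ z, T.CrossAt t.1 t.2 z := fun t ht => (hsub ht).2
    choose! c hc using hex
    obtain ⟨t, ht, hmax⟩ := Set.exists_max_image S.pending (fun t => (c t).1) hfin ⟨t₀, ht₀⟩
    have hmax' : ∀ t' ∈ S.pending, ∀ z', T.CrossAt t'.1 t'.2 z' → z'.1 ≤ (c t).1 :=
      fun t' ht' z' hz' => by
        rw [hSt.crossAt_unique (hsub ht') hz' (hc t' ht')]
        exact hmax t' ht'
    exact ⟨_, .intersectionEvent S v vs t (c t) hv ht (hc t ht)
      (hlt.le.trans (hmax' t₀ ht₀ z₀ hz₀)) hmax'⟩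

/-! ### Optimality -/

lemma ListInvariant.card_firsts {S : SweepState m} (hL : T.ListInvariant N S.lists) :
    S.firsts.card = S.output.card := by
  have hout : ∀ g, g ∈ S.output ↔ S.lists g ≠ [] := by simp [SweepState.output]
  symm
  refine Finset.card_bij (fun g hg => (S.lists g).head ((hout g).1 hg)) (fun g hg => ?_)
    (fun g hg g' hg' heq => ?_) fun f hf => ?_
  · simp only [SweepState.firsts, Finset.mem_filter, Finset.mem_univ, true_and]
    exact ⟨g, List.head?_eq_some_head _⟩
  · refine hL.disjoint g g' _ (List.head_mem ((hout g).1 hg)) ?_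
    rw [heq]
    exact List.head_mem _
  · simp only [SweepState.firsts, Finset.mem_filter, Finset.mem_univ, true_and] at hf
    obtain ⟨g, hg⟩ := hf
    have hne : S.lists g ≠ [] := fun h => by simp [h] at hg
    refine ⟨g, (hout g).2 hne, ?_⟩
    rw [List.head?_eq_some_head hne] at hg
    exact Option.some.inj hg

/-- The first elements need different guards each, so that no guarding set is smaller. -/
lemma ListInvariant.isOptimalGuarding {S : SweepState m} (hL : T.ListInvariant 0 S.lists) :
    T.IsOptimalGuarding T.reflexVertices T.leftConvexVertices S.output := by
  refine ⟨fun g hg => ?_, fun w hw => ?_, fun G' hG' hguard => ?_⟩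
  · simp only [SweepState.output, Finset.mem_filter, Finset.mem_univ, true_and] at hg
    obtain ⟨w, hw⟩ := List.exists_mem_of_ne_nil _ hg
    simpa [reflexVertices] using isReflex_iff.2 (hL.sound g w hw).1
  · simp only [leftConvexVertices, Finset.mem_filter, Finset.mem_univ, true_and] at hw
    obtain ⟨g, hg⟩ := hL.complete w (leftConvexAt_iff.2 hw) (Nat.zero_le _)
    refine ⟨g, ?_, (hL.sound g w hg).2.2.2⟩
    simpa [SweepState.output] using List.ne_nil_of_mem hg
  · rw [← hL.card_firsts]
    have hfirst : ∀ f, f ∈ S.firsts ↔ IsFirst S.lists f := fun f => by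
      simp [SweepState.firsts, IsFirst]
    have hex : ∀ f ∈ S.firsts, ∃ g ∈ G', T.Sees g f := fun f hf => by
      obtain ⟨g, hg⟩ := ((hfirst f).1 hf).exists_mem
      refine hguard f ?_
      simpa [leftConvexVertices] using leftConvexAt_iff.1 (hL.sound g f hg).2.1
    choose! c hc using hex
    refine Finset.card_le_card_of_injOn c (fun f hf => (hc f hf).1) fun f hf f' hf' heq => ?_
    have hr : T.ReflexAt (c f) := by
      have := hG' (hc f hf).1
      simp only [reflexVertices, Finset.mem_filter, Finset.mem_univ, true_and] at this
      exact isReflex_iff.1 this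
    exact hL.independent (c f) hr f f' ((hfirst f).1 hf) ((hfirst f').1 hf') (hc f hf).2
      (heq ▸ (hc f' hf').2)

end OrthogonalTerrain

theorem mainTheorem1 {m : ℕ} (T : OrthogonalTerrain m) :
    -- every run of the sweep stops after finitely many steps
    (¬ ∃ run : ℕ → SweepState m,
      run 0 = OrthogonalTerrain.initState m ∧ ∀ k, T.Step (run k) (run (k + 1))) ∧
    -- it never gets stuck before all vertices have been swept
    (∀ S : SweepState m, T.Reachable S → S.events ≠ [] → ∃ S', T.Step S S') ∧
    -- and what it returns in the end is an optimal solution, certified by the first elements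
    (∀ S : SweepState m, T.Reachable S → S.events = [] →
      T.IsOptimalGuarding T.reflexVertices T.leftConvexVertices S.output ∧
      S.firsts.card = S.output.card ∧
      ∀ r ∈ T.reflexVertices, ∀ u ∈ S.firsts, ∀ v ∈ S.firsts, u ≠ v →
        ¬ (T.Sees r u ∧ T.Sees r v)) := by
  refine ⟨?_, fun S hS hne => hS.sweepInvariant.exists_step hne, fun S hS hnil => ?_⟩
  · rintro ⟨run, h0, hstep⟩
    have hinv : ∀ k, T.SweepInvariant (run k) := by
      intro k
      induction k with
      | zero => rw [h0]; exact OrthogonalTerrain.sweepInvariant_initState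
      | succ k ih => exact ih.step (hstep k)
    exact not_strictAnti_of_wellFoundedLT (fun k => OrthogonalTerrain.sweepMeasure (run k))
      (strictAnti_nat_of_succ_lt fun k => (hinv k).measure_lt (hstep k))
  · obtain ⟨N, -, hN, hL, -⟩ := hS.sweepInvariant
    obtain rfl : N = 0 := by
      rw [hnil] at hN
      simpa using congrArg List.length hN.symm
    refine ⟨hL.isOptimalGuarding, hL.card_firsts, fun r hr u hu v hv huv hs => huv ?_⟩
    simp only [OrthogonalTerrain.reflexVertices, SweepState.firsts, Finset.mem_filter,
      Finset.mem_univ, true_and] at hr hu hv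
    exact hL.independent r (OrthogonalTerrain.isReflex_iff.1 hr) u v hu hv hs.1 hs.2
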